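/- **Theorem.** Let $N$ be a natural number, let $c_1,c_2\in\mathbb R$, $\rho_2>0$, and let $p_i,\xi_{i,0},C_i$ ($1\le i\le N$) be complex numbers with $$p_{N+1-i}^*=p_i,\qquad \xi_{N+1-i,0}^*=\xi_{i,0}\qquad(1\le i\le N),$$ such that $p_i+p_j^*\ne 0$ and $c_2\rho_2^2\neq p_ip_j^*$ for all $i,j$ (here $*$ is complex conjugation). For real $x,t$ put $$\xi_i=p_i\,(x-3c_2\rho_2^2t)+p_i^3t+\xi_{i,0},\qquad c_{ij}=\frac{c_1C_i^*C_j+c_1C_{N+1-i}C_{N+1-j}^*}{c_2\rho_2^2/(p_ip_j^*)-1},$$ $$(M_q)_{ij}=\frac1{p_i+p_j^*}\left(\Big(-\frac{p_i}{p_j^*}\Big)^q e^{\xi_i+\xi_j^*}+c_{ij}\right)\quad(q=0,1),$$ $$f=|M_0|,\qquad h_2=|M_1|,\qquad g_1=\begin{vmatrix}M_0&\Phi\\-\Psi^T&0\end{vmatrix},\qquad \Phi=(e^{\xi_1},\dots,e^{\xi_N})^T,\quad \Psi=(C_1,\dots,C_N)^T.$$ Then $v=\rho_2h_2/f$ is real-valued,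 and on the open set of points $(x,t)\in\mathbb R^2$ where $f\neq0$ the functions $$u=\frac{g_1}{f},\qquad v=\rho_2\frac{h_2}{f}$$ are smooth and satisfy the coupled Sasa–Satsuma–mKdV system $$u_t=u_{xxx}-6c_1|u|^2u_x-3c_1u\,(|u|^2)_x-3c_2v\,(uv)_x,$$ $$v_t=v_{xxx}-6c_1|u|^2v_x-3c_1v\,(|u|^2)_x-6c_2v^2v_x.$$ Moreover, suppose that the parameters are nondegenerate: the $p_i$ are pairwise distinct and the principal minors of the matrix $\big(c_{ij}/(p_i+p_j^*)\big)_{i,j}$ on the index sets $\{i:\operatorname{Re}p_i>0\}$ and $\{i:\operatorname{Re}p_i<0\}$ are nonzero (an empty minor being $1$). Then $(u,v)$ has the bright-dark boundary behaviour: for every fixed $t$, $f\ne0$ for all $x$ with $|x|$ large, and $u\to0$, $|v|\to\rho_2$ as $x\to\pm\infty$. -/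

import Mathlib

open Filter Topology
open scoped ComplexConjugate ContDiff Matrix

noncomputable section

namespace SSmKdV

/-- `(u, v)`, with `u` complex-valued and `v` real-valued, is a smooth classical solution on the set
`Ω` of points `(x, t)` of the coupled Sasa-Satsuma-mKdV system with real coefficients `c₁`, `c₂`:
`u_t = u_xxx - 6 c₁ |u|² u_x - 3 c₁ u (|u|²)_x - 3 c₂ v (u v)_x`,
`v_t = v_xxx - 6 c₁ |u|² v_x - 3 c₁ v (|u|²)_x - 6 c₂ v² v_x`. -/
structure IsSolutionOn (c₁ c₂ : ℝ) (u : ℝ → ℝ → ℂ) (v : ℝ → ℝ → ℝ) (Ω : Set (ℝ × ℝ)) : Prop where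
  isOpen : IsOpen Ω
  smooth_u : ContDiffOn ℝ ∞ (fun z : ℝ × ℝ => u z.1 z.2) Ω
  smooth_v : ContDiffOn ℝ ∞ (fun z : ℝ × ℝ => v z.1 z.2) Ω
  eq_u : ∀ x t : ℝ, (x, t) ∈ Ω →
    deriv (fun s => u x s) t =
      iteratedDeriv 3 (fun y => u y t) x
        - 6 * c₁ * ((‖u x t‖ ^ 2 : ℝ) : ℂ) * deriv (fun y => u y t) x
        - 3 * c₁ * u x t * ((deriv (fun y => ‖u y t‖ ^ 2) x : ℝ) : ℂ)
        - 3 * c₂ * (v x t : ℂ) * deriv (fun y => u y t * (v y t : ℂ)) x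
  eq_v : ∀ x t : ℝ, (x, t) ∈ Ω →
    deriv (fun s => v x s) t =
      iteratedDeriv 3 (fun y => v y t) x
        - 6 * c₁ * ‖u x t‖ ^ 2 * deriv (fun y => v y t) x
        - 3 * c₁ * v x t * deriv (fun y => ‖u y t‖ ^ 2) x
        - 6 * c₂ * v x t ^ 2 * deriv (fun y => v y t) x

/-- Bright-dark boundary conditions: at each time `t`, as `x → ±∞`, `u → 0` and `|v| → ρ₂`. -/
def BrightDarkBoundary (ρ₂ : ℝ) (u : ℝ → ℝ → ℂ) (v : ℝ → ℝ → ℝ) : Prop :=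
  ∀ t : ℝ, Tendsto (fun x => u x t) (atBot ⊔ atTop) (𝓝 0) ∧
    Tendsto (fun x => |v x t|) (atBot ⊔ atTop) (𝓝 ρ₂)

variable {N : ℕ}

/-- The phase `ξ_i = p_i (x - 3 c₂ ρ₂² t) + p_i³ t + ξ_{i,0}`. -/
def phase (c₂ ρ₂ : ℝ) (p ξ₀ : Fin N → ℂ) (x t : ℝ) (i : Fin N) : ℂ :=
  p i * ((x : ℂ) - 3 * c₂ * ρ₂ ^ 2 * t) + p i ^ 3 * t + ξ₀ i

/-- The coefficient `c_{ij}`. With indices in `{1, …, N}` the index `Fin.rev i` is `N + 1 - i`. -/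
def coeff (c₁ c₂ ρ₂ : ℝ) (p C : Fin N → ℂ) (i j : Fin N) : ℂ :=
  (c₁ * conj (C i) * C j + c₁ * C i.rev * conj (C j.rev)) /
    (c₂ * ρ₂ ^ 2 / (p i * conj (p j)) - 1)

/-- The matrix `M_q`. -/
def mat (c₁ c₂ ρ₂ : ℝ) (p ξ₀ C : Fin N → ℂ) (q : ℕ) (x t : ℝ) : Matrix (Fin N) (Fin N) ℂ :=
  Matrix.of fun i j =>
    1 / (p i + conj (p j)) *
      ((-(p i / conj (p j))) ^ q *
          Complex.exp (phase c₂ ρ₂ p ξ₀ x t i + conj (phase c₂ ρ₂ p ξ₀ x t j))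
        + coeff c₁ c₂ ρ₂ p C i j)

/-- `f = |M₀|`. -/
def f (c₁ c₂ ρ₂ : ℝ) (p ξ₀ C : Fin N → ℂ) (x t : ℝ) : ℂ :=
  (mat c₁ c₂ ρ₂ p ξ₀ C 0 x t).det

/-- `h₂ = |M₁|`. -/
def h₂ (c₁ c₂ ρ₂ : ℝ) (p ξ₀ C : Fin N → ℂ) (x t : ℝ) : ℂ :=
  (mat c₁ c₂ ρ₂ p ξ₀ C 1 x t).det

/-- The bordered determinant `g₁`: `M₀` with last column `Φ = (e^{ξ_1}, …, e^{ξ_N})ᵀ`, last row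
`-Ψᵀ = -(C_1, …, C_N)` and corner entry `0`. -/
def g₁ (c₁ c₂ ρ₂ : ℝ) (p ξ₀ C : Fin N → ℂ) (x t : ℝ) : ℂ :=
  (Matrix.fromBlocks (mat c₁ c₂ ρ₂ p ξ₀ C 0 x t)
    (Matrix.replicateCol Unit fun i => Complex.exp (phase c₂ ρ₂ p ξ₀ x t i))
    (Matrix.replicateRow Unit fun j => -C j) 0).det

/-- Nondegeneracy: the `p_i` are pairwise distinct, and the principal minors of the matrix
`(c_{ij} / (p_i + p_j^*))` on the index sets `{i : Re p_i > 0}` and `{i : Re p_i < 0}` do not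
vanish (an empty minor is `1`). -/
structure Nondegenerate (c₁ c₂ ρ₂ : ℝ) (p C : Fin N → ℂ) : Prop where
  injective : Function.Injective p
  det_pos : (Matrix.of fun i j : {i : Fin N // 0 < (p i).re} =>
    coeff c₁ c₂ ρ₂ p C i j / (p i + conj (p j))).det ≠ 0
  det_neg : (Matrix.of fun i j : {i : Fin N // (p i).re < 0} =>
    coeff c₁ c₂ ρ₂ p C i j / (p i + conj (p j))).det ≠ 0

end SSmKdV

end

/-! Put M = M₀, φ_k = PᵏΦ, ψ_k = Φ†(P†)ᵏ and κ = c₂ρ₂². By the Schur complement u = ΨᵀM⁻¹Φ, and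
since M₁ = M − ΦΦ†(P†)⁻¹, the quotient w = h₂/f is 1 − Φ†(P†)⁻¹M⁻¹Φ. Both are the case k = 0 of
scalars r_k (`rMoment`), with (d, ε) = (C, 0) and (0, 1). Let s_{jk} = ψ_j M⁻¹ φ_k (`sMoment`).

Since M_x = φ₀ψ₀ has rank one and M_t is a sum of such products, the moments satisfy r_k' = r_{k+1}
− r₀ s_{0k} and a similar formula in t. The symmetry i ↦ N+1−i gives s_{jk} = s_{kj}. Eliminating
the higher moments (`third_deriv_of_hierarchy`, `rMoment_linear_pde`) leaves one linear equation for
both u and w, r_t = r_xxx − 3κ r_x + 3q r_x + (3/2) q_x r, where q = (s₀₀)_x = 2s₀₁ − s₀₀².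

The nonlinearity enters only through q. The c_{ij} are chosen so that M obeys a displacement
identity of low rank; sandwiched between ψ₀M⁻¹ and M⁻¹φ₀ it gives q = κ − κw² − 2c₁|u|²
(`moment_relation`). Substituting this, with v = ρ₂w, turns the linear equation into the two
equations of the system.

For the boundary behaviour, rescale the rows and columns whose exponentials blow up. The limit of M
is block diagonal: a Cauchy block, nonsingular because the p_i are distinct, and a block that is
nonsingular by nondegeneracy. Passing from M₀ to M₁ multiplies the Cauchy minor by ∏(−p_i/p_i^*), of
modulus 1, and the limiting bordered determinant is 0 (`asymptotics_of_dichotomy`). -/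

namespace SSmKdV

/-! ### Derivatives of matrix expressions, and elimination in the moment hierarchy. -/

section Calculus

variable {ι : Type*} [Fintype ι]

lemma hasDerivAt_dotProduct {a b : ℝ → ι → ℂ} {a' b' : ι → ℂ} {x : ℝ}
    (ha : HasDerivAt a a' x) (hb : HasDerivAt b b' x) :
    HasDerivAt (fun y => a y ⬝ᵥ b y) (a' ⬝ᵥ b x + a x ⬝ᵥ b') x := by
  have := HasDerivAt.fun_sum (u := Finset.univ) (fun i _ => (hasDerivAt_pi.1 ha i).mul (hasDerivAt_pi.1 hb i))
  simpa [dotProduct, Finset.sum_add_distrib] using this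

lemma hasDerivAt_mulVec {M : ℝ → Matrix ι ι ℂ} {M' : Matrix ι ι ℂ} {b : ℝ → ι → ℂ} {b' : ι → ℂ}
    {x : ℝ} (hM : ∀ i j, HasDerivAt (fun y => M y i j) (M' i j) x) (hb : HasDerivAt b b' x) :
    HasDerivAt (fun y => M y *ᵥ b y) (M' *ᵥ b x + M x *ᵥ b') x := by
  rw [hasDerivAt_pi]
  intro i
  exact hasDerivAt_dotProduct (hasDerivAt_pi.2 fun j => hM i j) hb

variable [DecidableEq ι]

section

attribute [local instance] Matrix.linftyOpNormedRing Matrix.linftyOpNormedAlgebra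

/-- The operator norm is only a device for using the derivative of inversion in a normed algebra;
hypothesis and conclusion are entrywise, hence independent of the norm. -/
lemma hasDerivAt_matrix_inv {M : ℝ → Matrix ι ι ℂ} {M' : Matrix ι ι ℂ} {x : ℝ}
    (hM : ∀ i j, HasDerivAt (fun y => M y i j) (M' i j) x) (hdet : (M x).det ≠ 0) (i j : ι) :
    HasDerivAt (fun y => (M y)⁻¹ i j) (-((M x)⁻¹ * M' * (M x)⁻¹) i j) x := by
  have hu : IsUnit (M x) := (Matrix.isUnit_iff_isUnit_det _).2 hdet.isUnit
  obtain ⟨u, hu⟩ := hu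
  have hM' : HasDerivAt M M' x := hasDerivAt_pi.2 fun i => hasDerivAt_pi.2 fun j => hM i j
  have h := hasFDerivAt_ringInverse (𝕜 := ℝ) u
  rw [hu] at h
  have h2 := h.comp_hasDerivAt x hM'
  have h3 : HasDerivAt (fun y => (M y)⁻¹) (-((M x)⁻¹ * M' * (M x)⁻¹)) x := by
    convert! h2 using 1
    · funext y; simp [Matrix.nonsing_inv_eq_ringInverse]
    · simp [← hu, Matrix.coe_units_inv]
  exact hasDerivAt_pi.1 (hasDerivAt_pi.1 h3 i) j
end

lemma hasDerivAt_bilin_inv {M : ℝ → Matrix ι ι ℂ} {M' : Matrix ι ι ℂ} {a b : ℝ → ι → ℂ}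
    {a' b' : ι → ℂ} {x : ℝ}
    (hM : ∀ i j, HasDerivAt (fun y => M y i j) (M' i j) x) (hdet : (M x).det ≠ 0)
    (ha : HasDerivAt a a' x) (hb : HasDerivAt b b' x) :
    HasDerivAt (fun y => a y ⬝ᵥ (M y)⁻¹ *ᵥ b y)
      (a' ⬝ᵥ (M x)⁻¹ *ᵥ b x + a x ⬝ᵥ (M x)⁻¹ *ᵥ b'
        - a x ⬝ᵥ (M x)⁻¹ *ᵥ M' *ᵥ (M x)⁻¹ *ᵥ b x) x := by
  convert! hasDerivAt_dotProduct ha (hasDerivAt_mulVec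
    (M' := -((M x)⁻¹ * M' * (M x)⁻¹)) (hasDerivAt_matrix_inv hM hdet) hb) using 1
  simp only [dotProduct_add, Matrix.neg_mulVec, dotProduct_neg, Matrix.mulVec_mulVec]
  simp only [Matrix.mul_assoc]
  ring

lemma iteratedDeriv_three_of_hasDerivAt {E : Type*} [NormedAddCommGroup E] [NormedSpace ℝ E]
    {U : Set ℝ} (hU : IsOpen U) {g g₁ g₂ g₃ : ℝ → E}
    (h₁ : ∀ y ∈ U, HasDerivAt g (g₁ y) y) (h₂ : ∀ y ∈ U, HasDerivAt g₁ (g₂ y) y)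
    (h₃ : ∀ y ∈ U, HasDerivAt g₂ (g₃ y) y) {x : ℝ} (hx : x ∈ U) :
    iteratedDeriv 3 g x = g₃ x := by
  have e₁ : ∀ y ∈ U, deriv g =ᶠ[𝓝 y] g₁ := fun y hy =>
    Filter.mem_of_superset (hU.mem_nhds hy) fun z hz => (h₁ z hz).deriv
  have e₂ : ∀ y ∈ U, deriv (deriv g) =ᶠ[𝓝 y] g₂ := fun y hy =>
    Filter.mem_of_superset (hU.mem_nhds hy) fun z hz => (e₁ z hz).deriv_eq.trans (h₂ z hz).deriv
  rw [iteratedDeriv_succ, iteratedDeriv_succ, iteratedDeriv_one]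
  exact (e₂ x hx).deriv_eq.trans (h₃ x hx).deriv

/-- A real function whose complexification is differentiable on an open set is differentiable
there, with real derivative. -/
lemma hasDerivAt_of_ofReal {U : Set ℝ} (hU : IsOpen U) {v : ℝ → ℝ} {g g' : ℝ → ℂ}
    (hv : ∀ y ∈ U, (v y : ℂ) = g y) (hg : ∀ y ∈ U, HasDerivAt g (g' y) y) {y : ℝ} (hy : y ∈ U) :
    HasDerivAt v (g' y).re y ∧ (((g' y).re : ℝ) : ℂ) = g' y := by
  have hev : (fun z => (v z : ℂ)) =ᶠ[𝓝 y] g :=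
    Filter.mem_of_superset (hU.mem_nhds hy) fun z hz => hv z hz
  have h1 : HasDerivAt (fun z => (v z : ℂ)) (g' y) y := (hg y hy).congr_of_eventuallyEq hev
  have h2 : HasDerivAt v (g' y).re y := by
    exact (Complex.reCLM.hasFDerivAt (x := (v y : ℂ))).comp_hasDerivAt y h1
  exact ⟨h2, h2.ofReal_comp.unique h1⟩

/-- If `r₀' = r₁ - r₀ s₀`, `r₁' = r₂ - r₀ s₁`, `r₂' = r₃ - r₀ s₂` and `s₀' = q = 2 s₁ - s₀²`, then
`r₀''' = r₃ - r₂ s₀ + r₁ s₁ - r₀ s₂ - 3 q r₀' - (3/2) q' r₀`. -/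
lemma third_deriv_of_hierarchy {U : Set ℝ} (hU : IsOpen U)
    {r₀ r₁ r₂ r₃ s₀ s₁ s₂ q q' : ℝ → ℂ}
    (hr₀ : ∀ y ∈ U, HasDerivAt r₀ (r₁ y - r₀ y * s₀ y) y)
    (hr₁ : ∀ y ∈ U, HasDerivAt r₁ (r₂ y - r₀ y * s₁ y) y)
    (hr₂ : ∀ y ∈ U, HasDerivAt r₂ (r₃ y - r₀ y * s₂ y) y)
    (hs₀ : ∀ y ∈ U, HasDerivAt s₀ (q y) y)
    (hq : ∀ y ∈ U, q y = 2 * s₁ y - s₀ y ^ 2)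
    (hq' : ∀ y ∈ U, HasDerivAt q (q' y) y) :
    ∃ r₀₂ r₀₃ : ℝ → ℂ, (∀ y ∈ U, HasDerivAt (fun y => r₁ y - r₀ y * s₀ y) (r₀₂ y) y) ∧
      (∀ y ∈ U, HasDerivAt r₀₂ (r₀₃ y) y) ∧
      ∀ y ∈ U, r₀₃ y = r₃ y - r₂ y * s₀ y + r₁ y * s₁ y - r₀ y * s₂ y
        - 3 * q y * (r₁ y - r₀ y * s₀ y) - 3 / 2 * q' y * r₀ y := by
  -- Solving q = 2s₁ − s₀² for s₁ expresses s₁' through q' alone, so no further moments enter the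
  -- third derivative.
  have hs₁ : ∀ y ∈ U, HasDerivAt s₁ (q' y / 2 + s₀ y * q y) y := by
    intro y hy
    have h : HasDerivAt (fun z => (q z + s₀ z * s₀ z) / 2)
        ((q' y + (q y * s₀ y + s₀ y * q y)) / 2) y :=
      ((hq' y hy).add ((hs₀ y hy).mul (hs₀ y hy))).div_const 2
    have h2 : s₁ =ᶠ[𝓝 y] fun z => (q z + s₀ z * s₀ z) / 2 :=
      Filter.mem_of_superset (hU.mem_nhds hy) fun z hz => by
        simp only [Set.mem_ofPred_eq, hq z hz]; ring
    convert! h.congr_of_eventuallyEq h2 using 1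
    ring
  refine ⟨fun y => r₂ y - r₀ y * s₁ y - ((r₁ y - r₀ y * s₀ y) * s₀ y + r₀ y * q y),
    fun y => r₃ y - r₀ y * s₂ y - ((r₁ y - r₀ y * s₀ y) * s₁ y + r₀ y * (q' y / 2 + s₀ y * q y))
      - (((r₂ y - r₀ y * s₁ y - ((r₁ y - r₀ y * s₀ y) * s₀ y + r₀ y * q y)) * s₀ y
        + (r₁ y - r₀ y * s₀ y) * q y) + ((r₁ y - r₀ y * s₀ y) * q y + r₀ y * q' y)), ?_, ?_, ?_⟩
  · intro y hy
    exact (hr₁ y hy).sub ((hr₀ y hy).mul (hs₀ y hy))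
  · intro y hy
    exact ((hr₂ y hy).sub ((hr₀ y hy).mul (hs₁ y hy))).sub
      ((((hr₁ y hy).sub ((hr₀ y hy).mul (hs₀ y hy))).mul (hs₀ y hy)).add
        ((hr₀ y hy).mul (hq' y hy)))
  · intro y hy
    simp only
    rw [hq y hy]
    ring

end Calculus

/-! ### Symmetries of M⁻¹, Cauchy matrices, and rank-one determinant formulas. -/

section LinearAlgebra

variable {ι : Type*} [Fintype ι] [DecidableEq ι]

/-- Transposing M amounts to reindexing it by e, and inversion commutes with both operations, so M⁻¹
inherits the symmetry. -/
lemma bilin_inv_reflect {M : Matrix ι ι ℂ} {e : ι ≃ ι} (he : ∀ i, e (e i) = i)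
    (hM : ∀ i j, M (e j) (e i) = M i j) (a b : ι → ℂ) :
    a ⬝ᵥ M⁻¹ *ᵥ b = (b ∘ e) ⬝ᵥ M⁻¹ *ᵥ (a ∘ e) := by
  have h : (M⁻¹)ᵀ = M⁻¹.submatrix e e := by
    rw [← Matrix.inv_submatrix_equiv, Matrix.transpose_nonsing_inv]
    congr 1
    ext i j
    exact (hM j i).symm
  have h1 : (b ∘ e) ⬝ᵥ M⁻¹ *ᵥ (a ∘ e) = b ⬝ᵥ (M⁻¹.submatrix e e) *ᵥ a := by
    simp only [dotProduct, Matrix.mulVec, Matrix.submatrix_apply, Function.comp_apply]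
    rw [← Equiv.sum_comp e]
    refine Finset.sum_congr rfl fun i _ => ?_
    rw [← Equiv.sum_comp e]
    simp [he]
  rw [h1, ← h, Matrix.mulVec_transpose, Matrix.dotProduct_mulVec, dotProduct_comm]

/-- Here entrywise conjugation amounts to reindexing by e; it commutes with determinant and
adjugate, hence with inversion. -/
lemma conj_bilin_inv {M : Matrix ι ι ℂ} {e : ι ≃ ι}
    (hM : ∀ i j, M (e i) (e j) = conj (M i j)) (a b : ι → ℂ) :
    conj (a ⬝ᵥ M⁻¹ *ᵥ b) = (fun i => conj (a (e.symm i))) ⬝ᵥ M⁻¹ *ᵥ (fun i => conj (b (e.symm i))) := by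
  have h : M⁻¹.map (starRingEnd ℂ) = M⁻¹.submatrix e e := by
    rw [← Matrix.inv_submatrix_equiv]
    have : M.submatrix e e = M.map (starRingEnd ℂ) := by ext i j; exact hM i j
    rw [this, Matrix.inv_def, Matrix.inv_def]
    ext i j
    have h1 : (M.map (starRingEnd ℂ)).det = conj M.det := ((starRingEnd ℂ).map_det M).symm
    have h2 : (M.map (starRingEnd ℂ)).adjugate = M.adjugate.map (starRingEnd ℂ) :=
      ((starRingEnd ℂ).map_adjugate M).symm
    simp [h1, h2]
  have h' : ∀ i j, M⁻¹ (e i) (e j) = conj (M⁻¹ i j) := fun i j => (congrFun (congrFun h i) j).symm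
  simp only [dotProduct, Matrix.mulVec, map_sum, map_mul]
  symm
  rw [← Equiv.sum_comp e]
  refine Finset.sum_congr rfl fun i _ => ?_
  rw [← Equiv.sum_comp e]
  simp [h']

/-- A Cauchy matrix is nonsingular. -/
lemma det_cauchy_ne_zero {a b : ι → ℂ} (ha : Function.Injective a) (hb : Function.Injective b)
    (hab : ∀ i j, a i + b j ≠ 0) : (Matrix.of fun i j => 1 / (a i + b j)).det ≠ 0 := by
  intro h0
  obtain ⟨y, hy0, hy⟩ := Matrix.exists_mulVec_eq_zero_iff.2 h0
  apply hy0
  -- P is the numerator of ∑ y_j/(z + b_j) for a kernel vector y. It vanishes at every a_i and has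
  -- degree below their number, so P = 0; evaluating at −b_j then isolates y_j.
  let P : Polynomial ℂ := ∑ j, Polynomial.C (y j) *
    ∏ k ∈ Finset.univ.erase j, (Polynomial.X + Polynomial.C (b k))
  have hev : ∀ z, P.eval z = ∑ j, y j * ∏ k ∈ Finset.univ.erase j, (z + b k) := by
    intro z
    simp [P, Polynomial.eval_finsetSum, Polynomial.eval_prod]
  have hroot : ∀ i, P.eval (a i) = 0 := by
    intro i
    rw [hev]
    have h1 := congrFun hy i
    simp only [Matrix.mulVec, dotProduct, Matrix.of_apply, Pi.zero_apply] at h1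
    calc _ = (∏ k, (a i + b k)) * ∑ j, 1 / (a i + b j) * y j := by
          rw [Finset.mul_sum]
          refine Finset.sum_congr rfl fun j _ => ?_
          rw [← Finset.mul_prod_erase _ _ (Finset.mem_univ j)]
          field_simp [hab i j]
      _ = 0 := by rw [h1, mul_zero]
  have hdeg : P = 0 ∨ P.natDegree < Fintype.card ι := by
    by_cases hc : IsEmpty ι
    · left; simp [P]
    right
    rw [not_isEmpty_iff] at hc
    refine lt_of_le_of_lt (Polynomial.natDegree_sum_le_of_forall_le (n := Fintype.card ι - 1) _ _ ?_)
      (Nat.sub_lt Fintype.card_pos one_pos)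
    intro j _
    refine (Polynomial.natDegree_C_mul_le _ _).trans ((Polynomial.natDegree_prod_le _ _).trans ?_)
    simp [Finset.card_erase_of_mem]
  have hP : P = 0 := by
    rcases hdeg with h | h
    · exact h
    · exact Polynomial.eq_zero_of_natDegree_lt_card_of_eval_eq_zero P ha hroot h
  funext j
  have h2 := hev (-b j)
  rw [hP, Polynomial.eval_zero, Finset.sum_eq_single j] at h2
  · rcases mul_eq_zero.1 h2.symm with h | h
    · exact h
    · obtain ⟨k, hk, hk'⟩ := Finset.prod_eq_zero_iff.1 h
      exact absurd (hb (by linear_combination hk')) (Finset.ne_of_mem_erase hk)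
  · intro k _ hk
    rw [Finset.prod_eq_zero (i := j) (by simp [hk.symm]) (by ring), mul_zero]
  · simp

lemma det_bordered {M : Matrix ι ι ℂ} (h : M.det ≠ 0) (a b : ι → ℂ) :
    (Matrix.fromBlocks M (Matrix.replicateCol Unit b)
      (Matrix.replicateRow Unit fun j => -a j) 0).det = M.det * (a ⬝ᵥ M⁻¹ *ᵥ b) := by
  have : Invertible M := M.invertibleOfIsUnitDet h.isUnit
  rw [Matrix.det_fromBlocks₁₁, Matrix.invOf_eq_nonsing_inv]
  congr 1
  rw [Matrix.det_unique]
  rw [Matrix.mul_assoc]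
  simp [Matrix.mul_apply, dotProduct, Matrix.mulVec]

lemma det_sub_vecMulVec {M : Matrix ι ι ℂ} (h : M.det ≠ 0) (a b : ι → ℂ) :
    (M - Matrix.vecMulVec b a).det = M.det * (1 - a ⬝ᵥ M⁻¹ *ᵥ b) := by
  have h1 := Matrix.det_add_replicateCol_mul_replicateRow (ι := Unit) h.isUnit b (-a)
  have h2 : Matrix.replicateCol Unit b * Matrix.replicateRow Unit (-a) = -Matrix.vecMulVec b a := by
    ext i j; simp [Matrix.mul_apply, Matrix.vecMulVec_apply]
  rw [h2, ← sub_eq_add_neg] at h1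
  rw [h1, Matrix.mul_assoc]
  congr 1
  rw [Matrix.det_unique]
  simp [Matrix.mul_apply, dotProduct, Matrix.mulVec, sub_eq_add_neg]

end LinearAlgebra

/-! ### The scalar moments r_k and s_{jk}. -/

noncomputable section Moments

/-- The column vector `Pᵏ Φ`, where `θ` is the vector of phases. -/
def colVec {N : ℕ} (p θ : Fin N → ℂ) (k : ℕ) : Fin N → ℂ := fun i => p i ^ k * Complex.exp (θ i)

/-- The row vector `Φ† (P†)ᵏ`. -/
def rowVec {N : ℕ} (p θ : Fin N → ℂ) (k : ℕ) : Fin N → ℂ :=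
  fun j => conj (p j) ^ k * Complex.exp (conj (θ j))

/-- The row vector `d - ε Φ† (P†)⁻¹`. -/
def mixedRow {N : ℕ} (p θ d : Fin N → ℂ) (ε : ℂ) : Fin N → ℂ :=
  fun j => d j - ε * (Complex.exp (conj (θ j)) / conj (p j))

/-- The scalar `Φ† (P†)ʲ M₀⁻¹ Pᵏ Φ`. -/
def sMoment {N : ℕ} (c₁ c₂ ρ₂ : ℝ) (p ξ₀ C : Fin N → ℂ) (j k : ℕ) (x t : ℝ) : ℂ :=
  rowVec p (phase c₂ ρ₂ p ξ₀ x t) j ⬝ᵥ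
    (mat c₁ c₂ ρ₂ p ξ₀ C 0 x t)⁻¹ *ᵥ colVec p (phase c₂ ρ₂ p ξ₀ x t) k

/-- The scalar `ε δ_{k0} + (d - ε Φ† (P†)⁻¹) M₀⁻¹ Pᵏ Φ`. -/
def rMoment {N : ℕ} (c₁ c₂ ρ₂ : ℝ) (p ξ₀ C d : Fin N → ℂ) (ε : ℂ) (k : ℕ) (x t : ℝ) : ℂ :=
  (if k = 0 then ε else 0) + mixedRow p (phase c₂ ρ₂ p ξ₀ x t) d ε ⬝ᵥ
    (mat c₁ c₂ ρ₂ p ξ₀ C 0 x t)⁻¹ *ᵥ colVec p (phase c₂ ρ₂ p ξ₀ x t) k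

variable {N : ℕ} {c₁ c₂ ρ₂ : ℝ} {p ξ₀ C : Fin N → ℂ}

lemma ne_zero_of_add_conj_ne_zero (hpp : ∀ i j, p i + conj (p j) ≠ 0) (i : Fin N) : p i ≠ 0 := by
  intro h
  have := hpp i i
  simp [h] at this

/-! ### Evolution of the moments in x and t. -/

section Derivatives

lemma hasDerivAt_phase_x (i : Fin N) (x t : ℝ) :
    HasDerivAt (fun y => phase c₂ ρ₂ p ξ₀ y t i) (p i) x := by
  have h : HasDerivAt (fun y : ℝ => (y : ℂ)) 1 x := by simpa using (hasDerivAt_id x).ofReal_comp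
  simpa [phase] using
    ((((h.sub_const (3 * c₂ * ρ₂ ^ 2 * t : ℂ)).const_mul (p i)).add_const
      (p i ^ 3 * t)).add_const (ξ₀ i))

lemma hasDerivAt_phase_t (i : Fin N) (x t : ℝ) :
    HasDerivAt (fun s => phase c₂ ρ₂ p ξ₀ x s i) (p i ^ 3 - 3 * (c₂ * ρ₂ ^ 2) * p i) t := by
  have h : HasDerivAt (fun y : ℝ => (y : ℂ)) 1 t := by simpa using (hasDerivAt_id t).ofReal_comp
  convert! (((((h.const_mul (3 * c₂ * ρ₂ ^ 2 : ℂ)).const_sub (x : ℂ)).const_mul (p i)).add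
    (h.const_mul (p i ^ 3))).add_const (ξ₀ i)) using 1
  ring

lemma hasDerivAt_conj {g : ℝ → ℂ} {g' : ℂ} {x : ℝ} (h : HasDerivAt g g' x) :
    HasDerivAt (fun y => conj (g y)) (conj g') x :=
  (Complex.conjCLE.toContinuousLinearMap.hasFDerivAt (x := g x)).comp_hasDerivAt x h

lemma hasDerivAt_colVec_x (k : ℕ) (x t : ℝ) :
    HasDerivAt (fun y => colVec p (phase c₂ ρ₂ p ξ₀ y t) k)
      (colVec p (phase c₂ ρ₂ p ξ₀ x t) (k + 1)) x := by
  rw [hasDerivAt_pi]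
  intro i
  convert! ((hasDerivAt_phase_x (c₂ := c₂) (ρ₂ := ρ₂) (p := p) (ξ₀ := ξ₀) i x t).cexp).const_mul
    (p i ^ k) using 1
  simp only [colVec]; ring

lemma hasDerivAt_colVec_t (x t : ℝ) :
    HasDerivAt (fun s => colVec p (phase c₂ ρ₂ p ξ₀ x s) 0)
      (colVec p (phase c₂ ρ₂ p ξ₀ x t) 3
        - (3 * (c₂ * ρ₂ ^ 2) : ℂ) • colVec p (phase c₂ ρ₂ p ξ₀ x t) 1) t := by
  rw [hasDerivAt_pi]
  intro i
  convert! ((hasDerivAt_phase_t (c₂ := c₂) (ρ₂ := ρ₂) (p := p) (ξ₀ := ξ₀) i x t).cexp).const_mul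
    (p i ^ 0) using 1
  simp [colVec]; ring

lemma hasDerivAt_rowVec_x (k : ℕ) (x t : ℝ) :
    HasDerivAt (fun y => rowVec p (phase c₂ ρ₂ p ξ₀ y t) k)
      (rowVec p (phase c₂ ρ₂ p ξ₀ x t) (k + 1)) x := by
  rw [hasDerivAt_pi]
  intro i
  convert! ((hasDerivAt_conj (hasDerivAt_phase_x (c₂ := c₂) (ρ₂ := ρ₂) (p := p) (ξ₀ := ξ₀)
    i x t)).cexp).const_mul (conj (p i) ^ k) using 1
  simp only [rowVec]; ring

lemma hasDerivAt_mixedRow_x (hp0 : ∀ i, p i ≠ 0) (d : Fin N → ℂ) (ε : ℂ) (x t : ℝ) :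
    HasDerivAt (fun y => mixedRow p (phase c₂ ρ₂ p ξ₀ y t) d ε)
      (-ε • rowVec p (phase c₂ ρ₂ p ξ₀ x t) 0) x := by
  rw [hasDerivAt_pi]
  intro i
  have h0 : conj (p i) ≠ 0 := by simpa using hp0 i
  convert! ((((hasDerivAt_conj (hasDerivAt_phase_x (c₂ := c₂) (ρ₂ := ρ₂) (p := p) (ξ₀ := ξ₀)
    i x t)).cexp).div_const (conj (p i))).const_mul ε).const_sub (d i) using 1
  simp only [rowVec, Pi.smul_apply, smul_eq_mul, pow_zero, one_mul]; field_simp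

lemma hasDerivAt_mixedRow_t (hp0 : ∀ i, p i ≠ 0) (d : Fin N → ℂ) (ε : ℂ) (x t : ℝ) :
    HasDerivAt (fun s => mixedRow p (phase c₂ ρ₂ p ξ₀ x s) d ε)
      (-ε • (rowVec p (phase c₂ ρ₂ p ξ₀ x t) 2
        - (3 * (c₂ * ρ₂ ^ 2) : ℂ) • rowVec p (phase c₂ ρ₂ p ξ₀ x t) 0)) t := by
  rw [hasDerivAt_pi]
  intro i
  have h0 : conj (p i) ≠ 0 := by simpa using hp0 i
  convert! ((((hasDerivAt_conj (hasDerivAt_phase_t (c₂ := c₂) (ρ₂ := ρ₂) (p := p) (ξ₀ := ξ₀)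
    i x t)).cexp).div_const (conj (p i))).const_mul ε).const_sub (d i) using 1
  simp only [rowVec, Pi.smul_apply, Pi.sub_apply, smul_eq_mul, pow_zero, one_mul, map_sub, map_mul,
    map_pow, map_ofNat, Complex.conj_ofReal]
  field_simp

/-- Differentiating the exponential produces the factor p_i + p_j^*, which cancels the denominator
and leaves a product; the c_{ij} are constant. -/
lemma hasDerivAt_mat_x (hpp : ∀ i j, p i + conj (p j) ≠ 0) (i j : Fin N) (x t : ℝ) :
    HasDerivAt (fun y => mat c₁ c₂ ρ₂ p ξ₀ C 0 y t i j)
      (Matrix.vecMulVec (colVec p (phase c₂ ρ₂ p ξ₀ x t) 0)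
        (rowVec p (phase c₂ ρ₂ p ξ₀ x t) 0) i j) x := by
  have h := hpp i j
  have h1 := hasDerivAt_phase_x (c₂ := c₂) (ρ₂ := ρ₂) (p := p) (ξ₀ := ξ₀) i x t
  have h2 := hasDerivAt_conj (hasDerivAt_phase_x (c₂ := c₂) (ρ₂ := ρ₂) (p := p) (ξ₀ := ξ₀) j x t)
  convert! (((((h1.add h2).cexp).const_mul ((-(p i / conj (p j))) ^ 0)).add_const
    (coeff c₁ c₂ ρ₂ p C i j)).const_mul (1 / (p i + conj (p j)))) using 1
  simp only [Matrix.vecMulVec_apply, colVec, rowVec, Pi.add_apply, Complex.exp_add]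
  field_simp

/-- With a = p_i and b = p_j^*, the quotient (a³ + b³)/(a + b) = a² − ab + b² yields the three
products; the linear part of the phase yields the last. -/
lemma hasDerivAt_mat_t (hpp : ∀ i j, p i + conj (p j) ≠ 0) (i j : Fin N) (x t : ℝ) :
    HasDerivAt (fun s => mat c₁ c₂ ρ₂ p ξ₀ C 0 x s i j)
      ((Matrix.vecMulVec (colVec p (phase c₂ ρ₂ p ξ₀ x t) 2)
          (rowVec p (phase c₂ ρ₂ p ξ₀ x t) 0)
        - Matrix.vecMulVec (colVec p (phase c₂ ρ₂ p ξ₀ x t) 1)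
          (rowVec p (phase c₂ ρ₂ p ξ₀ x t) 1)
        + Matrix.vecMulVec (colVec p (phase c₂ ρ₂ p ξ₀ x t) 0)
          (rowVec p (phase c₂ ρ₂ p ξ₀ x t) 2)
        - (3 * (c₂ * ρ₂ ^ 2) : ℂ) • Matrix.vecMulVec (colVec p (phase c₂ ρ₂ p ξ₀ x t) 0)
          (rowVec p (phase c₂ ρ₂ p ξ₀ x t) 0)) i j) t := by
  have h := hpp i j
  have h1 := hasDerivAt_phase_t (c₂ := c₂) (ρ₂ := ρ₂) (p := p) (ξ₀ := ξ₀) i x t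
  have h2 := hasDerivAt_conj (hasDerivAt_phase_t (c₂ := c₂) (ρ₂ := ρ₂) (p := p) (ξ₀ := ξ₀) j x t)
  convert! (((((h1.add h2).cexp).const_mul ((-(p i / conj (p j))) ^ 0)).add_const
    (coeff c₁ c₂ ρ₂ p C i j)).const_mul (1 / (p i + conj (p j)))) using 1
  simp only [Matrix.vecMulVec_apply, colVec, rowVec, Pi.add_apply, Complex.exp_add, Matrix.sub_apply,
    Matrix.add_apply, Matrix.smul_apply, smul_eq_mul, map_sub, map_mul, map_pow, Complex.conj_ofReal,
    map_ofNat]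
  field_simp
  ring

lemma dotProduct_mulVec_vecMulVec_mulVec {ι : Type*} [Fintype ι] (W : Matrix ι ι ℂ)
    (a b c y : ι → ℂ) :
    a ⬝ᵥ W *ᵥ Matrix.vecMulVec b c *ᵥ y = (a ⬝ᵥ W *ᵥ b) * (c ⬝ᵥ y) := by
  rw [Matrix.vecMulVec_mulVec, Matrix.mulVec_smul, dotProduct_smul]
  simp [mul_comm]

lemma hasDerivAt_sMoment_x (hpp : ∀ i j, p i + conj (p j) ≠ 0) (j k : ℕ) {x t : ℝ}
    (hf : f c₁ c₂ ρ₂ p ξ₀ C x t ≠ 0) :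
    HasDerivAt (fun y => sMoment c₁ c₂ ρ₂ p ξ₀ C j k y t)
      (sMoment c₁ c₂ ρ₂ p ξ₀ C (j + 1) k x t + sMoment c₁ c₂ ρ₂ p ξ₀ C j (k + 1) x t
        - sMoment c₁ c₂ ρ₂ p ξ₀ C j 0 x t * sMoment c₁ c₂ ρ₂ p ξ₀ C 0 k x t) x := by
  convert! hasDerivAt_bilin_inv (fun i j => hasDerivAt_mat_x hpp i j x t) hf
    (hasDerivAt_rowVec_x j x t) (hasDerivAt_colVec_x k x t) using 1
  rw [dotProduct_mulVec_vecMulVec_mulVec]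
  rfl

/-- Differentiating the row contributes −ε s_{0k}. The constant ε included in r₀ absorbs exactly
this term, so the recursion has the same form for every d and ε. -/
lemma hasDerivAt_rMoment_x (hpp : ∀ i j, p i + conj (p j) ≠ 0) (d : Fin N → ℂ) (ε : ℂ) (k : ℕ)
    {x t : ℝ} (hf : f c₁ c₂ ρ₂ p ξ₀ C x t ≠ 0) :
    HasDerivAt (fun y => rMoment c₁ c₂ ρ₂ p ξ₀ C d ε k y t)
      (rMoment c₁ c₂ ρ₂ p ξ₀ C d ε (k + 1) x t
        - rMoment c₁ c₂ ρ₂ p ξ₀ C d ε 0 x t * sMoment c₁ c₂ ρ₂ p ξ₀ C 0 k x t) x := by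
  convert! (hasDerivAt_bilin_inv (fun i j => hasDerivAt_mat_x hpp i j x t) hf
    (hasDerivAt_mixedRow_x (ne_zero_of_add_conj_ne_zero hpp) d ε x t)
    (hasDerivAt_colVec_x k x t)).const_add (if k = 0 then ε else 0) using 1
  rw [dotProduct_mulVec_vecMulVec_mulVec]
  simp only [rMoment, sMoment, smul_dotProduct, smul_eq_mul, Nat.succ_ne_zero, if_true, if_false]
  ring

lemma hasDerivAt_rMoment_t (hpp : ∀ i j, p i + conj (p j) ≠ 0) (d : Fin N → ℂ) (ε : ℂ)
    {x t : ℝ} (hf : f c₁ c₂ ρ₂ p ξ₀ C x t ≠ 0) :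
    HasDerivAt (fun s => rMoment c₁ c₂ ρ₂ p ξ₀ C d ε 0 x s)
      (rMoment c₁ c₂ ρ₂ p ξ₀ C d ε 3 x t
        - rMoment c₁ c₂ ρ₂ p ξ₀ C d ε 2 x t * sMoment c₁ c₂ ρ₂ p ξ₀ C 0 0 x t
        + rMoment c₁ c₂ ρ₂ p ξ₀ C d ε 1 x t * sMoment c₁ c₂ ρ₂ p ξ₀ C 1 0 x t
        - rMoment c₁ c₂ ρ₂ p ξ₀ C d ε 0 x t * sMoment c₁ c₂ ρ₂ p ξ₀ C 2 0 x t
        - 3 * (c₂ * ρ₂ ^ 2) * (rMoment c₁ c₂ ρ₂ p ξ₀ C d ε 1 x t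
          - rMoment c₁ c₂ ρ₂ p ξ₀ C d ε 0 x t * sMoment c₁ c₂ ρ₂ p ξ₀ C 0 0 x t)) t := by
  convert! (hasDerivAt_bilin_inv (fun i j => hasDerivAt_mat_t hpp i j x t) hf
    (hasDerivAt_mixedRow_t (ne_zero_of_add_conj_ne_zero hpp) d ε x t)
    (hasDerivAt_colVec_t x t)).const_add (if 0 = 0 then ε else 0) using 1
  simp only [Matrix.sub_mulVec, Matrix.add_mulVec, Matrix.mulVec_sub, Matrix.mulVec_add,
    Matrix.smul_mulVec, Matrix.mulVec_smul, dotProduct_sub, dotProduct_add, dotProduct_smul,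
    dotProduct_mulVec_vecMulVec_mulVec, smul_dotProduct, sub_dotProduct]
  simp only [rMoment, sMoment, smul_eq_mul, if_true, OfNat.ofNat_ne_zero, one_ne_zero, if_false]
  ring

end Derivatives

/-! ### The symmetry i ↦ N+1−i and the quadratic relation between the moments. -/

section Symmetry

lemma phase_rev (hp : ∀ i, conj (p i.rev) = p i) (hξ₀ : ∀ i, conj (ξ₀ i.rev) = ξ₀ i)
    (x t : ℝ) (i : Fin N) :
    conj (phase c₂ ρ₂ p ξ₀ x t i.rev) = phase c₂ ρ₂ p ξ₀ x t i := by
  simp only [phase, map_add, map_sub, map_mul, map_pow, map_ofNat, Complex.conj_ofReal, hp, hξ₀]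

lemma conj_phase (hp : ∀ i, conj (p i.rev) = p i) (hξ₀ : ∀ i, conj (ξ₀ i.rev) = ξ₀ i)
    (x t : ℝ) (i : Fin N) :
    conj (phase c₂ ρ₂ p ξ₀ x t i) = phase c₂ ρ₂ p ξ₀ x t i.rev := by
  have := phase_rev (c₂ := c₂) (ρ₂ := ρ₂) hp hξ₀ x t i.rev
  rwa [Fin.rev_rev] at this

lemma conj_param (hp : ∀ i, conj (p i.rev) = p i) (i : Fin N) : conj (p i) = p i.rev := by
  have := hp i.rev
  rwa [Fin.rev_rev] at this

lemma mat_rev_rev (hp : ∀ i, conj (p i.rev) = p i) (hξ₀ : ∀ i, conj (ξ₀ i.rev) = ξ₀ i)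
    (q : ℕ) (x t : ℝ) (i j : Fin N) :
    mat c₁ c₂ ρ₂ p ξ₀ C q x t i.rev j.rev = conj (mat c₁ c₂ ρ₂ p ξ₀ C q x t i j) := by
  simp only [mat, coeff, Matrix.of_apply, map_mul, map_add, map_div₀, map_one, map_pow, map_neg,
    map_sub, Complex.conj_ofReal, ← Complex.exp_conj, Complex.conj_conj, conj_phase hp hξ₀,
    conj_param hp, Fin.rev_rev]
  ring

/-- The map (i, j) ↦ (N+1−j, N+1−i) swaps the two summands in the numerator of c_{ij} and the roles
of p_i and p_j^*. The factor (−p_i/p_j^*)^q would break this, hence q = 0. -/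
lemma mat_zero_rev_swap (hp : ∀ i, conj (p i.rev) = p i) (hξ₀ : ∀ i, conj (ξ₀ i.rev) = ξ₀ i)
    (x t : ℝ) (i j : Fin N) :
    mat c₁ c₂ ρ₂ p ξ₀ C 0 x t j.rev i.rev = mat c₁ c₂ ρ₂ p ξ₀ C 0 x t i j := by
  simp only [mat, coeff, Matrix.of_apply, conj_phase hp hξ₀, conj_param hp, Fin.rev_rev, pow_zero]
  rw [add_comm (p j.rev), add_comm (phase c₂ ρ₂ p ξ₀ x t j.rev), mul_comm (p j.rev)]
  ring

lemma colVec_rev (hp : ∀ i, conj (p i.rev) = p i) (hξ₀ : ∀ i, conj (ξ₀ i.rev) = ξ₀ i)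
    (k : ℕ) (x t : ℝ) :
    colVec p (phase c₂ ρ₂ p ξ₀ x t) k ∘ Fin.revPerm = rowVec p (phase c₂ ρ₂ p ξ₀ x t) k := by
  funext i
  simp [colVec, rowVec, conj_phase hp hξ₀, conj_param hp]

lemma rowVec_rev (hp : ∀ i, conj (p i.rev) = p i) (hξ₀ : ∀ i, conj (ξ₀ i.rev) = ξ₀ i)
    (k : ℕ) (x t : ℝ) :
    rowVec p (phase c₂ ρ₂ p ξ₀ x t) k ∘ Fin.revPerm = colVec p (phase c₂ ρ₂ p ξ₀ x t) k := by
  funext i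
  simp [colVec, rowVec, phase_rev hp hξ₀, hp]

lemma sMoment_comm (hp : ∀ i, conj (p i.rev) = p i) (hξ₀ : ∀ i, conj (ξ₀ i.rev) = ξ₀ i)
    (j k : ℕ) (x t : ℝ) :
    sMoment c₁ c₂ ρ₂ p ξ₀ C j k x t = sMoment c₁ c₂ ρ₂ p ξ₀ C k j x t := by
  rw [sMoment, bilin_inv_reflect (e := Fin.revPerm) (by simp)
    (fun i j => mat_zero_rev_swap hp hξ₀ x t i j), colVec_rev hp hξ₀, rowVec_rev hp hξ₀]
  rfl

lemma conj_det_mat (hp : ∀ i, conj (p i.rev) = p i) (hξ₀ : ∀ i, conj (ξ₀ i.rev) = ξ₀ i)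
    (q : ℕ) (x t : ℝ) :
    conj (mat c₁ c₂ ρ₂ p ξ₀ C q x t).det = (mat c₁ c₂ ρ₂ p ξ₀ C q x t).det := by
  have h : (starRingEnd ℂ).mapMatrix (mat c₁ c₂ ρ₂ p ξ₀ C q x t)
      = (mat c₁ c₂ ρ₂ p ξ₀ C q x t).submatrix Fin.revPerm Fin.revPerm := by
    ext i j
    exact (mat_rev_rev hp hξ₀ q x t i j).symm
  rw [RingHom.map_det, h, Matrix.det_submatrix_equiv_self]

/-- If `(αᵢ + βⱼ) Mᵢⱼ` is a combination of rank one matrices, sandwiching by `M⁻¹` yields a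
quadratic relation between the scalars `a M⁻¹ b`. -/
lemma bilin_inv_displacement {ι : Type*} [Fintype ι] [DecidableEq ι] {M : Matrix ι ι ℂ}
    (hM : M.det ≠ 0) {α β φ ψ φ' ψ' e d e' d' : ι → ℂ} {κ c : ℂ}
    (h : ∀ i j, (α i + β j) * M i j
      = φ i * ψ j - κ * (φ' i * ψ' j) - c * (e i * d j + e' i * d' j)) :
    ψ ⬝ᵥ M⁻¹ *ᵥ (α * φ) + (β * ψ) ⬝ᵥ M⁻¹ *ᵥ φ
      = (ψ ⬝ᵥ M⁻¹ *ᵥ φ) * (ψ ⬝ᵥ M⁻¹ *ᵥ φ) - κ * ((ψ ⬝ᵥ M⁻¹ *ᵥ φ') * (ψ' ⬝ᵥ M⁻¹ *ᵥ φ))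
        - c * ((ψ ⬝ᵥ M⁻¹ *ᵥ e) * (d ⬝ᵥ M⁻¹ *ᵥ φ) + (ψ ⬝ᵥ M⁻¹ *ᵥ e') * (d' ⬝ᵥ M⁻¹ *ᵥ φ)) := by
  have hm : Matrix.diagonal α * M + M * Matrix.diagonal β
      = Matrix.vecMulVec φ ψ - κ • Matrix.vecMulVec φ' ψ'
        - c • (Matrix.vecMulVec e d + Matrix.vecMulVec e' d') := by
    ext i j
    simp only [Matrix.add_apply, Matrix.sub_apply, Matrix.smul_apply, Matrix.diagonal_mul,
      Matrix.mul_diagonal, Matrix.vecMulVec_apply, smul_eq_mul]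
    rw [← h i j]; ring
  have hu : IsUnit M.det := hM.isUnit
  -- With A and B the two diagonal matrices, M⁻¹(AM + MB)M⁻¹ = M⁻¹A + BM⁻¹.
  have key : ψ ⬝ᵥ M⁻¹ *ᵥ ((Matrix.diagonal α * M + M * Matrix.diagonal β) *ᵥ M⁻¹ *ᵥ φ)
      = ψ ⬝ᵥ M⁻¹ *ᵥ (α * φ) + (β * ψ) ⬝ᵥ M⁻¹ *ᵥ φ := by
    have h1 : (Matrix.diagonal α * M + M * Matrix.diagonal β) *ᵥ M⁻¹ *ᵥ φ
        = α * φ + M *ᵥ (β * (M⁻¹ *ᵥ φ)) := by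
      rw [Matrix.add_mulVec, ← Matrix.mulVec_mulVec, ← Matrix.mulVec_mulVec,
        Matrix.mulVec_mulVec φ M, Matrix.mul_nonsing_inv M hu, Matrix.one_mulVec]
      congr 1
      · funext i; simp [Matrix.mulVec_diagonal]
      · congr 1; funext i; simp [Matrix.mulVec_diagonal]
    rw [h1, Matrix.mulVec_add, Matrix.mulVec_mulVec _ M⁻¹ M, Matrix.nonsing_inv_mul M hu,
      Matrix.one_mulVec, dotProduct_add]
    congr 1
    simp only [dotProduct, Pi.mul_apply]
    exact Finset.sum_congr rfl fun i _ => by ring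
  rw [← key, hm]
  simp only [Matrix.sub_mulVec, Matrix.add_mulVec, Matrix.mulVec_sub, Matrix.mulVec_add,
    Matrix.smul_mulVec, Matrix.mulVec_smul, dotProduct_sub, dotProduct_add, dotProduct_smul,
    dotProduct_mulVec_vecMulVec_mulVec, smul_eq_mul]

lemma coeff_mul_sub_one (hcoeff : ∀ i j, (c₂ * ρ₂ ^ 2 / (p i * conj (p j)) - 1 : ℂ) ≠ 0)
    (i j : Fin N) :
    coeff c₁ c₂ ρ₂ p C i j * (c₂ * ρ₂ ^ 2 / (p i * conj (p j)) - 1)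
      = c₁ * (conj (C i) * C j + C i.rev * conj (C j.rev)) := by
  rw [coeff, div_mul_cancel₀ _ (hcoeff i j)]
  ring

/-- `(Φ† M₀⁻¹ Φ)_x = c₂ρ₂² - c₂ρ₂² w² - 2 c₁ |u|²`. -/
lemma moment_relation (hp : ∀ i, conj (p i.rev) = p i) (hξ₀ : ∀ i, conj (ξ₀ i.rev) = ξ₀ i)
    (hpp : ∀ i j, p i + conj (p j) ≠ 0)
    (hcoeff : ∀ i j, (c₂ * ρ₂ ^ 2 / (p i * conj (p j)) - 1 : ℂ) ≠ 0) {x t : ℝ}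
    (hf : f c₁ c₂ ρ₂ p ξ₀ C x t ≠ 0) :
    2 * sMoment c₁ c₂ ρ₂ p ξ₀ C 0 1 x t - sMoment c₁ c₂ ρ₂ p ξ₀ C 0 0 x t ^ 2
      = c₂ * ρ₂ ^ 2 - c₂ * ρ₂ ^ 2 * rMoment c₁ c₂ ρ₂ p ξ₀ C 0 1 0 x t ^ 2
        - 2 * c₁ * (rMoment c₁ c₂ ρ₂ p ξ₀ C C 0 0 x t
          * conj (rMoment c₁ c₂ ρ₂ p ξ₀ C C 0 0 x t)) := by
  have hp0 := ne_zero_of_add_conj_ne_zero hpp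
  have hb0 : ∀ i, conj (p i) ≠ 0 := fun i => by simpa using hp0 i
  set θ := phase c₂ ρ₂ p ξ₀ x t with hθ
  set M := mat c₁ c₂ ρ₂ p ξ₀ C 0 x t with hM
  set κ : ℂ := c₂ * ρ₂ ^ 2 with hκ
  have hrefl := bilin_inv_reflect (M := M) (e := Fin.revPerm) (by simp)
    (fun i j => mat_zero_rev_swap hp hξ₀ x t i j)
  let φ := colVec p θ 0
  let ψ := rowVec p θ 0
  have hφ : φ ∘ Fin.revPerm = ψ := colVec_rev hp hξ₀ 0 x t
  have hψ : ψ ∘ Fin.revPerm = φ := rowVec_rev hp hξ₀ 0 x t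
  let φ' : Fin N → ℂ := fun i => φ i / p i
  let ψ' : Fin N → ℂ := fun i => ψ i / conj (p i)
  have hφ' : φ' ∘ Fin.revPerm = ψ' := by
    funext i
    simp only [φ', ψ', Function.comp_apply, Fin.revPerm_apply, conj_param hp, ← hφ]
  -- Chosen so that α_i + β_j = (p_i + p_j^*)(1 − κ/(p_i p_j^*)): the first factor clears the
  -- denominator of M and the second, up to sign, that of c_{ij}.
  let α : Fin N → ℂ := fun i => p i - κ / p i
  let β : Fin N → ℂ := fun i => conj (p i) - κ / conj (p i)
  have hβψ : (β * ψ) ∘ Fin.revPerm = α * φ := by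
    funext i
    simp only [α, β, Function.comp_apply, Fin.revPerm_apply, Pi.mul_apply, hp, ← hψ]
  have hdisp := bilin_inv_displacement (M := M) hf (α := α) (β := β) (φ := φ) (ψ := ψ) (φ' := φ')
    (ψ' := ψ') (e := fun i => conj (C i)) (d := C) (e' := fun i => C i.rev)
    (d' := fun i => conj (C i.rev)) (κ := κ) (c := c₁) (by
      intro i j
      rw [← coeff_mul_sub_one hcoeff i j]
      have h1 := hp0 i
      have h2 := hb0 j
      have h3 := hpp i j
      simp only [α, β, φ, ψ, φ', ψ', hM, mat, Matrix.of_apply, colVec, rowVec, Complex.exp_add,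
        ← hθ, ← hκ]
      field_simp
      ring)
  have hu : C ⬝ᵥ M⁻¹ *ᵥ φ = rMoment c₁ c₂ ρ₂ p ξ₀ C C 0 0 x t := by
    have : mixedRow p θ C 0 = C := by funext i; simp [mixedRow]
    simp only [rMoment, ← hθ, ← hM, this, φ, if_true, zero_add]
  have hconj := conj_bilin_inv (M := M) (e := Fin.revPerm)
    (fun i j => mat_rev_rev hp hξ₀ 0 x t i j) C φ
  have hcφ : (fun i => conj (φ (Fin.revPerm.symm i))) = φ := by
    funext i
    simp [φ, colVec, hθ, ← Complex.exp_conj, phase_rev hp hξ₀]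
  rw [hcφ, hu] at hconj
  have hw : ψ' ⬝ᵥ M⁻¹ *ᵥ φ = 1 - rMoment c₁ c₂ ρ₂ p ξ₀ C 0 1 0 x t := by
    have : mixedRow p θ 0 1 = -ψ' := by funext i; simp [mixedRow, ψ', ψ, rowVec]
    simp only [rMoment, ← hθ, ← hM, this, φ, if_true, neg_dotProduct]
    ring
  have hw' : ψ ⬝ᵥ M⁻¹ *ᵥ φ' = 1 - rMoment c₁ c₂ ρ₂ p ξ₀ C 0 1 0 x t := by
    rw [hrefl, hφ', hψ, hw]
  have hαφ : ψ ⬝ᵥ M⁻¹ *ᵥ (α * φ) = sMoment c₁ c₂ ρ₂ p ξ₀ C 0 1 x t - κ * (ψ ⬝ᵥ M⁻¹ *ᵥ φ') := by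
    have : α * φ = colVec p θ 1 - κ • φ' := by
      funext i
      simp only [α, φ', φ, colVec, Pi.mul_apply, Pi.sub_apply, Pi.smul_apply, smul_eq_mul]
      ring
    rw [this, Matrix.mulVec_sub, Matrix.mulVec_smul, dotProduct_sub, dotProduct_smul]
    rfl
  have hβ : (β * ψ) ⬝ᵥ M⁻¹ *ᵥ φ = ψ ⬝ᵥ M⁻¹ *ᵥ (α * φ) := by
    rw [hrefl, hβψ, hφ]
  have he : ψ ⬝ᵥ M⁻¹ *ᵥ (fun i => conj (C i)) = conj (rMoment c₁ c₂ ρ₂ p ξ₀ C C 0 0 x t) := by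
    rw [hrefl, hψ, hconj]
    rfl
  have he' : ψ ⬝ᵥ M⁻¹ *ᵥ (fun i => C i.rev) = rMoment c₁ c₂ ρ₂ p ξ₀ C C 0 0 x t := by
    rw [hrefl, hψ, ← hu]
    congr 1
    funext i
    simp
  have hd' : (fun i => conj (C i.rev)) ⬝ᵥ M⁻¹ *ᵥ φ = conj (rMoment c₁ c₂ ρ₂ p ξ₀ C C 0 0 x t) := by
    rw [hconj]
    rfl
  have hs : ψ ⬝ᵥ M⁻¹ *ᵥ φ = sMoment c₁ c₂ ρ₂ p ξ₀ C 0 0 x t := rfl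
  -- The identity now reads 2(s₀₁ − κ(1 − w)) = s₀₀² − κ(1 − w)² − 2c₁|u|²; each of the two summands
  -- of c_{ij} has contributed one |u|².
  rw [hβ, hαφ, hw', hw, hu, he, he', hd', hs] at hdisp
  linear_combination hdisp

end Symmetry

end Moments

/-! ### Smoothness of the determinants, and openness of the set where f ≠ 0. -/

section Smoothness

lemma contDiff_matrix_det {E ι : Type*} [NormedAddCommGroup E] [NormedSpace ℝ E] [Fintype ι]
    [DecidableEq ι] {M : E → Matrix ι ι ℂ} {n : WithTop ℕ∞}
    (hM : ∀ i j, ContDiff ℝ n fun z => M z i j) : ContDiff ℝ n fun z => (M z).det := by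
  simp only [Matrix.det_apply]
  exact ContDiff.sum fun σ _ => (contDiff_prod fun i _ => hM _ _).const_smul _

lemma contDiffOn_div_complex {E : Type*} [NormedAddCommGroup E] [NormedSpace ℝ E] {a b : E → ℂ}
    {n : WithTop ℕ∞} (ha : ContDiff ℝ n a) (hb : ContDiff ℝ n b) :
    ContDiffOn ℝ n (fun z => a z / b z) {z | b z ≠ 0} := by
  simp only [div_eq_mul_inv]
  exact ha.contDiffOn.mul (hb.contDiffOn.inv fun z hz => hz)

variable {N : ℕ} (c₁ c₂ ρ₂ : ℝ) (p ξ₀ C : Fin N → ℂ)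

lemma contDiff_phase (i : Fin N) :
    ContDiff ℝ ∞ fun z : ℝ × ℝ => phase c₂ ρ₂ p ξ₀ z.1 z.2 i := by
  have h1 : ContDiff ℝ ∞ fun z : ℝ × ℝ => (z.1 : ℂ) := Complex.ofRealCLM.contDiff.comp contDiff_fst
  have h2 : ContDiff ℝ ∞ fun z : ℝ × ℝ => (z.2 : ℂ) := Complex.ofRealCLM.contDiff.comp contDiff_snd
  unfold phase
  fun_prop

lemma contDiff_mat (q : ℕ) (i j : Fin N) :
    ContDiff ℝ ∞ fun z : ℝ × ℝ => mat c₁ c₂ ρ₂ p ξ₀ C q z.1 z.2 i j := by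
  have h1 := contDiff_phase c₂ ρ₂ p ξ₀ i
  have h2 : ContDiff ℝ ∞ fun z : ℝ × ℝ => conj (phase c₂ ρ₂ p ξ₀ z.1 z.2 j) :=
    Complex.conjCLE.contDiff.comp (contDiff_phase c₂ ρ₂ p ξ₀ j)
  exact contDiff_const.mul ((contDiff_const.mul (h1.add h2).cexp).add contDiff_const)

lemma contDiff_f : ContDiff ℝ ∞ fun z : ℝ × ℝ => f c₁ c₂ ρ₂ p ξ₀ C z.1 z.2 :=
  contDiff_matrix_det (contDiff_mat c₁ c₂ ρ₂ p ξ₀ C 0)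

lemma contDiff_h₂ : ContDiff ℝ ∞ fun z : ℝ × ℝ => h₂ c₁ c₂ ρ₂ p ξ₀ C z.1 z.2 :=
  contDiff_matrix_det (contDiff_mat c₁ c₂ ρ₂ p ξ₀ C 1)

lemma contDiff_g₁ : ContDiff ℝ ∞ fun z : ℝ × ℝ => g₁ c₁ c₂ ρ₂ p ξ₀ C z.1 z.2 := by
  refine contDiff_matrix_det ?_
  rintro (i | i) (j | j)
  · exact contDiff_mat c₁ c₂ ρ₂ p ξ₀ C 0 i j
  · exact (contDiff_phase c₂ ρ₂ p ξ₀ i).cexp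
  · exact contDiff_const
  · exact contDiff_const

lemma isOpen_f_ne_zero : IsOpen {z : ℝ × ℝ | f c₁ c₂ ρ₂ p ξ₀ C z.1 z.2 ≠ 0} :=
  isOpen_ne.preimage (contDiff_f c₁ c₂ ρ₂ p ξ₀ C).continuous

lemma isOpen_f_ne_zero_x (t : ℝ) : IsOpen {y | f c₁ c₂ ρ₂ p ξ₀ C y t ≠ 0} :=
  (isOpen_f_ne_zero c₁ c₂ ρ₂ p ξ₀ C).preimage (Continuous.prodMk_left t)

lemma isOpen_f_ne_zero_t (x : ℝ) : IsOpen {s | f c₁ c₂ ρ₂ p ξ₀ C x s ≠ 0} :=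
  (isOpen_f_ne_zero c₁ c₂ ρ₂ p ξ₀ C).preimage (Continuous.prodMk_right x)

end Smoothness

/-! ### From the moments to the coupled system. -/

variable {N : ℕ} {c₁ c₂ ρ₂ : ℝ} {p ξ₀ C : Fin N → ℂ}

lemma g₁_div_f {x t : ℝ} (hf : f c₁ c₂ ρ₂ p ξ₀ C x t ≠ 0) :
    g₁ c₁ c₂ ρ₂ p ξ₀ C x t / f c₁ c₂ ρ₂ p ξ₀ C x t = rMoment c₁ c₂ ρ₂ p ξ₀ C C 0 0 x t := by
  have h := det_bordered (M := mat c₁ c₂ ρ₂ p ξ₀ C 0 x t) hf C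
    (fun i => Complex.exp (phase c₂ ρ₂ p ξ₀ x t i))
  rw [div_eq_iff hf, g₁, h, mul_comm]
  have hr : mixedRow p (phase c₂ ρ₂ p ξ₀ x t) C 0 = C := by funext i; simp [mixedRow]
  have hc : colVec p (phase c₂ ρ₂ p ξ₀ x t) 0
      = fun i => Complex.exp (phase c₂ ρ₂ p ξ₀ x t i) := by
    funext j; simp [colVec]
  rw [rMoment, hr, hc, if_pos rfl, zero_add, f]

lemma h₂_div_f (hpp : ∀ i j, p i + conj (p j) ≠ 0) {x t : ℝ}
    (hf : f c₁ c₂ ρ₂ p ξ₀ C x t ≠ 0) :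
    h₂ c₁ c₂ ρ₂ p ξ₀ C x t / f c₁ c₂ ρ₂ p ξ₀ C x t = rMoment c₁ c₂ ρ₂ p ξ₀ C 0 1 0 x t := by
  have h := det_sub_vecMulVec (M := mat c₁ c₂ ρ₂ p ξ₀ C 0 x t) hf
    (fun j => Complex.exp (conj (phase c₂ ρ₂ p ξ₀ x t j)) / conj (p j))
    (fun i => Complex.exp (phase c₂ ρ₂ p ξ₀ x t i))
  have hm : mat c₁ c₂ ρ₂ p ξ₀ C 0 x t - Matrix.vecMulVec
      (fun i => Complex.exp (phase c₂ ρ₂ p ξ₀ x t i))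
      (fun j => Complex.exp (conj (phase c₂ ρ₂ p ξ₀ x t j)) / conj (p j))
      = mat c₁ c₂ ρ₂ p ξ₀ C 1 x t := by
    ext i j
    have h1 := hpp i j
    have h2 : conj (p j) ≠ 0 := by simpa using ne_zero_of_add_conj_ne_zero hpp j
    simp only [mat, Matrix.sub_apply, Matrix.of_apply, Matrix.vecMulVec_apply, Complex.exp_add]
    field_simp
    ring
  rw [hm] at h
  have hr : mixedRow p (phase c₂ ρ₂ p ξ₀ x t) 0 1
      = -fun j => Complex.exp (conj (phase c₂ ρ₂ p ξ₀ x t j)) / conj (p j) := by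
    funext j; simp [mixedRow]
  have hc : colVec p (phase c₂ ρ₂ p ξ₀ x t) 0
      = fun i => Complex.exp (phase c₂ ρ₂ p ξ₀ x t i) := by
    funext j; simp [colVec]
  rw [div_eq_iff hf, h₂, h, rMoment, hr, hc, neg_dotProduct, if_pos rfl, f]
  ring

/-- Both `u` and `w` solve `r_t = r_xxx - 3 c₂ρ₂² r_x + 3 q r_x + (3/2) q_x r`, where
`q = (Φ† M₀⁻¹ Φ)_x`. -/
lemma rMoment_linear_pde (hp : ∀ i, conj (p i.rev) = p i) (hξ₀ : ∀ i, conj (ξ₀ i.rev) = ξ₀ i)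
    (hpp : ∀ i j, p i + conj (p j) ≠ 0) (t : ℝ) {q' : ℝ → ℂ}
    (hq' : ∀ y ∈ {y | f c₁ c₂ ρ₂ p ξ₀ C y t ≠ 0}, HasDerivAt (fun z =>
      2 * sMoment c₁ c₂ ρ₂ p ξ₀ C 0 1 z t - sMoment c₁ c₂ ρ₂ p ξ₀ C 0 0 z t ^ 2) (q' y) y)
    (d : Fin N → ℂ) (ε : ℂ) :
    ∃ g' g'' g''' : ℝ → ℂ,
      (∀ y, g' y = rMoment c₁ c₂ ρ₂ p ξ₀ C d ε 1 y t
        - rMoment c₁ c₂ ρ₂ p ξ₀ C d ε 0 y t * sMoment c₁ c₂ ρ₂ p ξ₀ C 0 0 y t) ∧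
      (∀ y ∈ {y | f c₁ c₂ ρ₂ p ξ₀ C y t ≠ 0},
        HasDerivAt (fun z => rMoment c₁ c₂ ρ₂ p ξ₀ C d ε 0 z t) (g' y) y) ∧
      (∀ y ∈ {y | f c₁ c₂ ρ₂ p ξ₀ C y t ≠ 0}, HasDerivAt g' (g'' y) y) ∧
      (∀ y ∈ {y | f c₁ c₂ ρ₂ p ξ₀ C y t ≠ 0}, HasDerivAt g'' (g''' y) y) ∧
      ∀ y ∈ {y | f c₁ c₂ ρ₂ p ξ₀ C y t ≠ 0},
        HasDerivAt (fun s => rMoment c₁ c₂ ρ₂ p ξ₀ C d ε 0 y s)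
          (g''' y - 3 * (c₂ * ρ₂ ^ 2) * g' y
            + 3 * (2 * sMoment c₁ c₂ ρ₂ p ξ₀ C 0 1 y t - sMoment c₁ c₂ ρ₂ p ξ₀ C 0 0 y t ^ 2) * g' y
            + 3 / 2 * q' y * rMoment c₁ c₂ ρ₂ p ξ₀ C d ε 0 y t) t := by
  obtain ⟨g'', g''', h2, h3, h⟩ := third_deriv_of_hierarchy (isOpen_f_ne_zero_x c₁ c₂ ρ₂ p ξ₀ C t)
    (fun y hy => hasDerivAt_rMoment_x hpp d ε 0 hy) (fun y hy => hasDerivAt_rMoment_x hpp d ε 1 hy)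
    (fun y hy => hasDerivAt_rMoment_x hpp d ε 2 hy)
    (q := fun z => 2 * sMoment c₁ c₂ ρ₂ p ξ₀ C 0 1 z t - sMoment c₁ c₂ ρ₂ p ξ₀ C 0 0 z t ^ 2)
    (fun y hy => by
      convert! hasDerivAt_sMoment_x hpp 0 0 hy using 1
      rw [zero_add, sMoment_comm hp hξ₀ 1 0]; ring) (fun y _ => rfl) hq'
  refine ⟨_, g'', g''', fun y => rfl, fun y hy => hasDerivAt_rMoment_x hpp d ε 0 hy, h2, h3,
    fun y hy => ?_⟩
  -- The combination r₃ − r₂s₀₀ + r₁s₁₀ − r₀s₂₀ in r_t is, after s_{j0} = s_{0j}, the one appearing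
  -- in the third x-derivative.
  convert! hasDerivAt_rMoment_t hpp d ε hy using 1
  rw [h y hy, sMoment_comm hp hξ₀ 1 0, sMoment_comm hp hξ₀ 2 0]
  ring

/-- The functions `u = g₁ / f` and `v = ρ₂ h₂ / f` solve the coupled system. -/
lemma isSolutionOn (hp : ∀ i, conj (p i.rev) = p i) (hξ₀ : ∀ i, conj (ξ₀ i.rev) = ξ₀ i)
    (hpp : ∀ i j, p i + conj (p j) ≠ 0)
    (hcoeff : ∀ i j, (c₂ * ρ₂ ^ 2 / (p i * conj (p j)) - 1 : ℂ) ≠ 0)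
    {u : ℝ → ℝ → ℂ} {v : ℝ → ℝ → ℝ}
    (hu : ∀ x t, u x t = g₁ c₁ c₂ ρ₂ p ξ₀ C x t / f c₁ c₂ ρ₂ p ξ₀ C x t)
    (hv : ∀ x t, (v x t : ℂ) = ρ₂ * (h₂ c₁ c₂ ρ₂ p ξ₀ C x t / f c₁ c₂ ρ₂ p ξ₀ C x t)) :
    IsSolutionOn c₁ c₂ u v {z | f c₁ c₂ ρ₂ p ξ₀ C z.1 z.2 ≠ 0} := by
  have hfc := contDiff_f c₁ c₂ ρ₂ p ξ₀ C
  have hpde : ∀ x t, f c₁ c₂ ρ₂ p ξ₀ C x t ≠ 0 → ∃ (ux uxxx : ℂ) (vx vxxx nx : ℝ),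
      HasDerivAt (fun y => u y t) ux x ∧ iteratedDeriv 3 (fun y => u y t) x = uxxx ∧
      HasDerivAt (fun y => v y t) vx x ∧ iteratedDeriv 3 (fun y => v y t) x = vxxx ∧
      HasDerivAt (fun y => ‖u y t‖ ^ 2) nx x ∧
      HasDerivAt (fun s => u x s) (uxxx - 6 * c₁ * ((‖u x t‖ ^ 2 : ℝ) : ℂ) * ux
        - 3 * c₁ * u x t * (nx : ℂ)
        - 3 * c₂ * (v x t : ℂ) * (ux * v x t + u x t * vx)) t ∧
      HasDerivAt (fun s => v x s) (vxxx - 6 * c₁ * ‖u x t‖ ^ 2 * vx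
        - 3 * c₁ * v x t * nx - 6 * c₂ * v x t ^ 2 * vx) t := by
    intro x t hxt
    have hU := isOpen_f_ne_zero_x c₁ c₂ ρ₂ p ξ₀ C t
    have hT := isOpen_f_ne_zero_t c₁ c₂ ρ₂ p ξ₀ C x
    have hur : ∀ y s, f c₁ c₂ ρ₂ p ξ₀ C y s ≠ 0 → u y s = rMoment c₁ c₂ ρ₂ p ξ₀ C C 0 0 y s :=
      fun y s hy => (hu y s).trans (g₁_div_f hy)
    have hvr : ∀ y s, f c₁ c₂ ρ₂ p ξ₀ C y s ≠ 0 →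
        (v y s : ℂ) = ρ₂ * rMoment c₁ c₂ ρ₂ p ξ₀ C 0 1 0 y s :=
      fun y s hy => (hv y s).trans (by rw [h₂_div_f hpp hy])
    let ux : ℝ → ℂ := fun y => rMoment c₁ c₂ ρ₂ p ξ₀ C C 0 1 y t
        - rMoment c₁ c₂ ρ₂ p ξ₀ C C 0 0 y t * sMoment c₁ c₂ ρ₂ p ξ₀ C 0 0 y t
    let wx : ℝ → ℂ := fun y => rMoment c₁ c₂ ρ₂ p ξ₀ C 0 1 1 y t
        - rMoment c₁ c₂ ρ₂ p ξ₀ C 0 1 0 y t * sMoment c₁ c₂ ρ₂ p ξ₀ C 0 0 y t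
    have hux : ∀ y ∈ {y | f c₁ c₂ ρ₂ p ξ₀ C y t ≠ 0},
        HasDerivAt (fun z => rMoment c₁ c₂ ρ₂ p ξ₀ C C 0 0 z t) (ux y) y :=
      fun y hy => hasDerivAt_rMoment_x hpp C 0 0 hy
    have hwx : ∀ y ∈ {y | f c₁ c₂ ρ₂ p ξ₀ C y t ≠ 0},
        HasDerivAt (fun z => rMoment c₁ c₂ ρ₂ p ξ₀ C 0 1 0 z t) (wx y) y :=
      fun y hy => hasDerivAt_rMoment_x hpp 0 1 0 hy
    -- The x-derivative of κ − κw² − 2c₁|u|², so that q_x involves only u, w and their first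
    -- derivatives.
    let q' : ℝ → ℂ := fun y => -(2 * (c₂ * ρ₂ ^ 2) * rMoment c₁ c₂ ρ₂ p ξ₀ C 0 1 0 y t * wx y)
      - 2 * c₁ * (ux y * conj (rMoment c₁ c₂ ρ₂ p ξ₀ C C 0 0 y t)
        + rMoment c₁ c₂ ρ₂ p ξ₀ C C 0 0 y t * conj (ux y))
    have hq' : ∀ y ∈ {y | f c₁ c₂ ρ₂ p ξ₀ C y t ≠ 0}, HasDerivAt (fun z =>
        2 * sMoment c₁ c₂ ρ₂ p ξ₀ C 0 1 z t - sMoment c₁ c₂ ρ₂ p ξ₀ C 0 0 z t ^ 2) (q' y) y := by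
      intro y hy
      have h1 := (((hwx y hy).pow 2).const_mul (c₂ * ρ₂ ^ 2 : ℂ)).const_sub (c₂ * ρ₂ ^ 2 : ℂ)
      have h2 := ((hux y hy).mul (hasDerivAt_conj (hux y hy))).const_mul (2 * c₁ : ℂ)
      have h3 : (fun z => 2 * sMoment c₁ c₂ ρ₂ p ξ₀ C 0 1 z t
          - sMoment c₁ c₂ ρ₂ p ξ₀ C 0 0 z t ^ 2) =ᶠ[𝓝 y] _ :=
        Filter.mem_of_superset (hU.mem_nhds hy) fun z hz => moment_relation hp hξ₀ hpp hcoeff hz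
      convert! (h1.sub h2).congr_of_eventuallyEq h3 using 1
      simp only [q']
      ring
    obtain ⟨ux', uxx, uxxx, hux', hu1, hu2, hu3, hut⟩ :=
      rMoment_linear_pde hp hξ₀ hpp t hq' C 0
    obtain ⟨wx', wxx, wxxx, hwx', hw1, hw2, hw3, hwt⟩ :=
      rMoment_linear_pde hp hξ₀ hpp t hq' 0 1
    obtain rfl : ux' = ux := funext hux'
    obtain rfl : wx' = wx := funext hwx'
    have hu0 : ∀ y ∈ {y | f c₁ c₂ ρ₂ p ξ₀ C y t ≠ 0}, HasDerivAt (fun y => u y t) (ux y) y :=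
      fun y hy => (hu1 y hy).congr_of_eventuallyEq
        (Filter.mem_of_superset (hU.mem_nhds hy) fun z hz => hur z t hz)
    have hv1 := fun y hy => hasDerivAt_of_ofReal (y := y) hU (v := fun y => v y t)
      (fun y hy => hvr y t hy) (fun y hy => (hw1 y hy).const_mul (ρ₂ : ℂ)) hy
    have hv2 := fun y hy => hasDerivAt_of_ofReal (y := y) hU (fun y hy => (hv1 y hy).2)
      (fun y hy => (hw2 y hy).const_mul (ρ₂ : ℂ)) hy
    have hv3 := fun y hy => hasDerivAt_of_ofReal (y := y) hU (fun y hy => (hv2 y hy).2)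
      (fun y hy => (hw3 y hy).const_mul (ρ₂ : ℂ)) hy
    have hnorm : ∀ y s, ((‖u y s‖ ^ 2 : ℝ) : ℂ) = u y s * conj (u y s) := fun y s => by
      rw [Complex.mul_conj, Complex.normSq_eq_norm_sq]
    have hn := hasDerivAt_of_ofReal (y := x) hU (v := fun y => ‖u y t‖ ^ 2)
      (fun y _ => hnorm y t) (fun y hy => (hu0 y hy).mul (hasDerivAt_conj (hu0 y hy))) hxt
    have hut' := (hut x hxt).congr_of_eventuallyEq
      (Filter.mem_of_superset (hT.mem_nhds hxt) fun s hs => hur x s hs)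
    have hvt' := (((hwt x hxt).const_mul (ρ₂ : ℂ)).congr_of_eventuallyEq
      (Filter.mem_of_superset (hT.mem_nhds hxt) fun s hs => hvr x s hs))
    have hrel := moment_relation hp hξ₀ hpp hcoeff hxt
    refine ⟨ux x, uxxx x, _, _, _, hu0 x hxt, iteratedDeriv_three_of_hasDerivAt hU hu0 hu2 hu3 hxt,
      (hv1 x hxt).1, iteratedDeriv_three_of_hasDerivAt hU (fun y hy => (hv1 y hy).1)
        (fun y hy => (hv2 y hy).1) (fun y hy => (hv3 y hy).1) hxt, hn.1, ?_, ?_⟩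
    · convert! hut' using 1
      rw [hrel, hn.2, (hv1 x hxt).2, hnorm, hur x t hxt, hvr x t hxt]
      simp only [q']
      ring
    -- The complex equation for ρ₂w is projected to real parts; the proposed right-hand side is
    -- real, so equality may be checked in ℂ.
    · have h := (Complex.reCLM.hasFDerivAt (x := (v x t : ℂ))).comp_hasDerivAt t hvt'
      have h' : HasDerivAt (fun s => v x s) _ t := h
      convert! h' using 1
      rw [← Complex.ofReal_re (_ - _)]
      simp only [Complex.reCLM_apply]
      congr 1
      push_cast
      have hn' := hnorm x t
      push_cast at hn'
      rw [hn', hrel, hn.2, (hv1 x hxt).2, (hv3 x hxt).2, hur x t hxt, hvr x t hxt]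
      simp only [q']
      ring
  refine ⟨isOpen_f_ne_zero c₁ c₂ ρ₂ p ξ₀ C, ?_, ?_, ?_, ?_⟩
  · simp only [hu]
    exact contDiffOn_div_complex (contDiff_g₁ c₁ c₂ ρ₂ p ξ₀ C) hfc
  · have h1 : (fun z : ℝ × ℝ => v z.1 z.2) = fun z => Complex.reCLM
        (ρ₂ * (h₂ c₁ c₂ ρ₂ p ξ₀ C z.1 z.2 / f c₁ c₂ ρ₂ p ξ₀ C z.1 z.2)) := by
      funext z
      rw [← hv, Complex.reCLM_apply, Complex.ofReal_re]
    rw [h1]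
    exact Complex.reCLM.contDiff.comp_contDiffOn (contDiffOn_const.mul
      (contDiffOn_div_complex (contDiff_h₂ c₁ c₂ ρ₂ p ξ₀ C) hfc))
  · intro x t hxt
    obtain ⟨ux, uxxx, vx, vxxx, nx, hux, huxxx, hvx, -, hn, hut, -⟩ := hpde x t hxt
    rw [hut.deriv, hux.deriv, huxxx, hn.deriv]
    congr 2
    exact (hux.mul hvx.ofReal_comp).deriv.symm
  · intro x t hxt
    obtain ⟨ux, uxxx, vx, vxxx, nx, -, -, hvx, hvxxx, hn, -, hvt⟩ := hpde x t hxt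
    rw [hvt.deriv, hvx.deriv, hvxxx, hn.deriv]

/-! ### Boundary behaviour as x → ±∞. -/

section Asymptotics

variable {N : ℕ} {c₁ c₂ ρ₂ : ℝ} {p ξ₀ C : Fin N → ℂ}

lemma tendsto_matrix_det {α ι : Type*} [Fintype ι] [DecidableEq ι] {l : Filter α}
    {M : α → Matrix ι ι ℂ} {L : Matrix ι ι ℂ}
    (h : ∀ i j, Tendsto (fun x => M x i j) l (𝓝 (L i j))) :
    Tendsto (fun x => (M x).det) l (𝓝 L.det) :=
  ((continuous_id.matrix_det).tendsto L).comp
    (tendsto_pi_nhds.2 fun i => tendsto_pi_nhds.2 fun j => h i j)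

lemma exists_re_phase_eq (c₂ ρ₂ : ℝ) (p ξ₀ : Fin N → ℂ) (t : ℝ) (i : Fin N) :
    ∃ c : ℝ, ∀ x, (phase c₂ ρ₂ p ξ₀ x t i).re = (p i).re * x + c := by
  refine ⟨(phase c₂ ρ₂ p ξ₀ 0 t i).re, fun x => ?_⟩
  have h : phase c₂ ρ₂ p ξ₀ x t i = p i * x + phase c₂ ρ₂ p ξ₀ 0 t i := by
    simp only [phase, Complex.ofReal_zero]; ring
  rw [h, Complex.add_re, Complex.re_mul_ofReal]

lemma tendsto_exp_zero {z : ℝ → ℂ} {l : Filter ℝ} (h : Tendsto (fun x => (z x).re) l atBot) :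
    Tendsto (fun x => Complex.exp (z x)) l (𝓝 0) :=
  tendsto_zero_iff_norm_tendsto_zero.2 (by
    simpa only [Complex.norm_exp, Function.comp_def] using Real.tendsto_exp_atBot.comp h)

/-- If the exponentials `e^{ξ_i}` blow up along `l` for `i ∈ S` and tend to zero otherwise, then
along `l` we have `f ≠ 0`, `u → 0` and `|h₂ / f| → 1`. -/
lemma asymptotics_of_dichotomy (hpp : ∀ i j, p i + conj (p j) ≠ 0) (hinj : Function.Injective p)
    (S : Fin N → Prop) [DecidablePred S]
    (hdet : (Matrix.toSquareBlockProp
      (Matrix.of fun i j => coeff c₁ c₂ ρ₂ p C i j / (p i + conj (p j))) fun i => ¬S i).det ≠ 0)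
    (l : Filter ℝ) (t : ℝ)
    (hS : ∀ i, S i → Tendsto (fun x => Complex.exp (-phase c₂ ρ₂ p ξ₀ x t i)) l (𝓝 0))
    (hS' : ∀ i, ¬S i → Tendsto (fun x => Complex.exp (phase c₂ ρ₂ p ξ₀ x t i)) l (𝓝 0)) :
    (∀ᶠ x in l, f c₁ c₂ ρ₂ p ξ₀ C x t ≠ 0) ∧
      Tendsto (fun x => g₁ c₁ c₂ ρ₂ p ξ₀ C x t / f c₁ c₂ ρ₂ p ξ₀ C x t) l (𝓝 0) ∧
      Tendsto (fun x => ‖h₂ c₁ c₂ ρ₂ p ξ₀ C x t / f c₁ c₂ ρ₂ p ξ₀ C x t‖) l (𝓝 1) := by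
  have hp0 := ne_zero_of_add_conj_ne_zero hpp
  -- E rescales row i, and its conjugate column i, by e^{−ξ_i} exactly where e^{ξ_i} blows up; e is
  -- the rescaled exponential, and E₀, e₀ are the limits, the indicators of the complement of S and
  -- of S.
  let E : ℝ → Fin N → ℂ := fun x i =>
    if S i then Complex.exp (-phase c₂ ρ₂ p ξ₀ x t i) else 1
  let e : ℝ → Fin N → ℂ := fun x i => if S i then 1 else Complex.exp (phase c₂ ρ₂ p ξ₀ x t i)
  let E₀ : Fin N → ℂ := fun i => if S i then 0 else 1
  let e₀ : Fin N → ℂ := fun i => if S i then 1 else 0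
  have hE0 : ∀ x i, E x i ≠ 0 := fun x i => by
    by_cases h : S i <;> simp [E, h, Complex.exp_ne_zero]
  have hEe : ∀ x i, E x i * Complex.exp (phase c₂ ρ₂ p ξ₀ x t i) = e x i := fun x i => by
    by_cases h : S i <;> simp [E, e, h, ← Complex.exp_add]
  have hE : ∀ i, Tendsto (fun x => E x i) l (𝓝 (E₀ i)) := fun i => by
    by_cases h : S i
    · simpa only [E, E₀, h, if_true] using hS i h
    · simpa only [E, E₀, h, if_false] using tendsto_const_nhds
  have he : ∀ i, Tendsto (fun x => e x i) l (𝓝 (e₀ i)) := fun i => by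
    by_cases h : S i
    · simpa only [e, e₀, h, if_true] using tendsto_const_nhds
    · simpa only [e, e₀, h, if_false] using hS' i h
  have hcE₀ : ∀ i, conj (E₀ i) = E₀ i := fun i => by by_cases h : S i <;> simp [E₀, h]
  have hce₀ : ∀ i, conj (e₀ i) = e₀ i := fun i => by by_cases h : S i <;> simp [e₀, h]
  have hcE : ∀ i, Tendsto (fun x => conj (E x i)) l (𝓝 (E₀ i)) := fun i => by
    simpa only [hcE₀, Function.comp_def] using (Complex.continuous_conj.tendsto _).comp (hE i)
  have hce : ∀ i, Tendsto (fun x => conj (e x i)) l (𝓝 (e₀ i)) := fun i => by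
    simpa only [hce₀, Function.comp_def] using (Complex.continuous_conj.tendsto _).comp (he i)
  let L : ℕ → Matrix (Fin N) (Fin N) ℂ := fun q => Matrix.of fun i j =>
    1 / (p i + conj (p j)) * ((-(p i / conj (p j))) ^ q * (e₀ i * e₀ j)
      + coeff c₁ c₂ ρ₂ p C i j * (E₀ i * E₀ j))
  let scaled : ℕ → ℝ → Matrix (Fin N) (Fin N) ℂ := fun q x =>
    Matrix.diagonal (E x) * mat c₁ c₂ ρ₂ p ξ₀ C q x t * Matrix.diagonal fun j => conj (E x j)
  have hscaled : ∀ q i j, Tendsto (fun x => scaled q x i j) l (𝓝 (L q i j)) := by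
    intro q i j
    have h : ∀ x, scaled q x i j = 1 / (p i + conj (p j)) *
        ((-(p i / conj (p j))) ^ q * (e x i * conj (e x j))
          + coeff c₁ c₂ ρ₂ p C i j * (E x i * conj (E x j))) := by
      intro x
      simp only [scaled, Matrix.mul_diagonal, Matrix.diagonal_mul, mat, Matrix.of_apply, ← hEe,
        map_mul, ← Complex.exp_conj, Complex.exp_add]
      ring
    simp only [h]
    exact ((((he i).mul (hce j)).const_mul _).add (((hE i).mul (hcE j)).const_mul _)).const_mul _
  -- The common factor that rescaling puts on f, h₂ and g₁; it cancels in the quotients.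
  let D : ℝ → ℂ := fun x => (∏ i, E x i) * ∏ i, conj (E x i)
  have hD : ∀ x, D x ≠ 0 := fun x => mul_ne_zero (Finset.prod_ne_zero_iff.2 fun i _ => hE0 x i)
    (Finset.prod_ne_zero_iff.2 fun i _ => by simpa using hE0 x i)
  have hscaled_det : ∀ q x, (scaled q x).det = D x * (mat c₁ c₂ ρ₂ p ξ₀ C q x t).det := by
    intro q x
    simp only [scaled, Matrix.det_mul, Matrix.det_diagonal, D]
    ring
  have hL : ∀ q i j, (S i ∧ ¬S j) ∨ (¬S i ∧ S j) → L q i j = 0 := by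
    rintro q i j (⟨hi, hj⟩ | ⟨hi, hj⟩) <;> simp [L, E₀, e₀, hi, hj]
  -- The block off S can be taken from L 0 for every q, since the factor depending on q multiplies
  -- e₀, which vanishes there.
  have hLdet : ∀ q, (L q).det = ((L q).toSquareBlockProp S).det *
      ((L 0).toSquareBlockProp fun i => ¬S i).det := by
    intro q
    rw [Matrix.twoBlockTriangular_det (L q) S fun i hi j hj => hL q i j (Or.inr ⟨hi, hj⟩)]
    congr 2
    ext i j
    have hi := i.2
    have hj := j.2
    simp [Matrix.toSquareBlockProp, L, E₀, e₀, hi, hj]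
  have hLc : ((L 0).toSquareBlockProp fun i => ¬S i).det ≠ 0 := by
    convert! hdet using 2
    ext i j
    have hi := i.2
    have hj := j.2
    simp only [Matrix.toSquareBlockProp, Matrix.toBlock_apply, L, E₀, e₀, hi, hj, Matrix.of_apply, if_false]
    ring
  have hcauchy : ((L 0).toSquareBlockProp S).det ≠ 0 := by
    have h := det_cauchy_ne_zero (ι := {i // S i}) (a := fun i => p i) (b := fun i => conj (p i))
      (fun i j hij => Subtype.ext (hinj hij))
      (fun i j hij => Subtype.ext (hinj ((starRingEnd ℂ).injective hij))) (fun i j => hpp i j)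
    convert! h using 2
    ext i j
    have hi := i.2
    have hj := j.2
    simp [Matrix.toSquareBlockProp, L, E₀, e₀, hi, hj]
  have hL1 : ((L 1).toSquareBlockProp S).det
      = (∏ i : {i // S i}, -(p i / conj (p i))) * ((L 0).toSquareBlockProp S).det := by
    -- On S the entry −p_i/p_j^* splits into a row factor and a column factor.
    have h : (L 1).toSquareBlockProp S = Matrix.diagonal (fun i : {i // S i} => -p i)
        * (L 0).toSquareBlockProp S * Matrix.diagonal (fun i : {i // S i} => (conj (p i))⁻¹) := by
      ext i j
      have hi := i.2
      have hj := j.2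
      simp only [Matrix.toSquareBlockProp, Matrix.toBlock_apply, Matrix.mul_diagonal, Matrix.diagonal_mul, L, E₀, e₀, hi,
        hj, Matrix.of_apply, if_true]
      ring
    rw [h, Matrix.det_mul, Matrix.det_mul, Matrix.det_diagonal, Matrix.det_diagonal, mul_right_comm,
      ← Finset.prod_mul_distrib]
    congr 1
    exact Finset.prod_congr rfl fun i _ => by ring
  have hL0 : (L 0).det ≠ 0 := by
    rw [hLdet]
    exact mul_ne_zero hcauchy hLc
  have hlim : ∀ q, Tendsto (fun x => (scaled q x).det) l (𝓝 (L q).det) :=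
    fun q => tendsto_matrix_det (hscaled q)
  refine ⟨?_, ?_, ?_⟩
  · filter_upwards [(hlim 0).eventually_ne hL0] with x hx hfx
    apply hx
    rw [hscaled_det]
    exact mul_eq_zero_of_right _ hfx
  · have hg : Tendsto (fun x => D x * g₁ c₁ c₂ ρ₂ p ξ₀ C x t) l (𝓝 0) := by
      have h0 : (Matrix.fromBlocks (L 0) (Matrix.replicateCol Unit e₀)
          (Matrix.replicateRow Unit fun j => -(C j * E₀ j)) 0).det = 0 := by
        rw [det_bordered hL0 (fun j => C j * E₀ j)]
        -- The limiting column is supported on S and the limiting row off S. The block-diagonal L 0,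
        -- and hence its inverse, commutes with the projection onto S, so their pairing through the
        -- inverse vanishes.
        have hcomm : Commute (L 0) (Matrix.diagonal e₀) := by
          ext i j
          rw [Matrix.mul_diagonal, Matrix.diagonal_mul]
          by_cases hi : S i <;> by_cases hj : S j <;>
            simp [e₀, hi, hj, hL 0 i j, mul_comm]
        have hu : IsUnit (L 0).det := hL0.isUnit
        have hinv : (L 0)⁻¹ * Matrix.diagonal e₀ = Matrix.diagonal e₀ * (L 0)⁻¹ := by
          calc (L 0)⁻¹ * Matrix.diagonal e₀
              = (L 0)⁻¹ * (Matrix.diagonal e₀ * L 0) * (L 0)⁻¹ := by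
                rw [Matrix.mul_assoc, Matrix.mul_assoc, Matrix.mul_nonsing_inv _ hu, Matrix.mul_one]
            _ = Matrix.diagonal e₀ * (L 0)⁻¹ := by
                rw [← hcomm.eq, ← Matrix.mul_assoc, Matrix.nonsing_inv_mul _ hu, Matrix.one_mul]
        have he₀ : Matrix.diagonal e₀ *ᵥ e₀ = e₀ := by
          funext i
          by_cases h : S i <;> simp [Matrix.mulVec_diagonal, e₀, h]
        rw [← he₀, Matrix.mulVec_mulVec, hinv, ← Matrix.mulVec_mulVec, dotProduct,
          Finset.sum_eq_zero, mul_zero]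
        intro i _
        rw [Matrix.mulVec_diagonal]
        by_cases h : S i <;> simp [e₀, E₀, h]
      rw [← h0]
      have hb : ∀ x, D x * g₁ c₁ c₂ ρ₂ p ξ₀ C x t
          = (Matrix.fromBlocks (scaled 0 x) (Matrix.replicateCol Unit (e x))
            (Matrix.replicateRow Unit fun j => -(C j * conj (E x j))) 0).det := by
        intro x
        have h : Matrix.fromBlocks (scaled 0 x) (Matrix.replicateCol Unit (e x))
            (Matrix.replicateRow Unit fun j => -(C j * conj (E x j))) 0
            = Matrix.fromBlocks (Matrix.diagonal (E x)) 0 0 1 *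
              Matrix.fromBlocks (mat c₁ c₂ ρ₂ p ξ₀ C 0 x t)
                (Matrix.replicateCol Unit fun i => Complex.exp (phase c₂ ρ₂ p ξ₀ x t i))
                (Matrix.replicateRow Unit fun j => -C j) (0 : Matrix Unit Unit ℂ) *
              Matrix.fromBlocks (Matrix.diagonal fun j => conj (E x j)) 0 0 1 := by
          rw [Matrix.fromBlocks_multiply, Matrix.fromBlocks_multiply]
          congr 1
          · simp [scaled]
          · ext i j; simp [Matrix.diagonal_mul, hEe]
          · ext i j; simp [Matrix.mul_diagonal]
          · simp
        rw [h, Matrix.det_mul, Matrix.det_mul, Matrix.det_fromBlocks_zero₂₁,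
          Matrix.det_fromBlocks_zero₂₁, Matrix.det_diagonal, Matrix.det_diagonal, Matrix.det_one,
          g₁]
        simp only [D]
        ring
      simp only [hb]
      refine tendsto_matrix_det ?_
      rintro (i | i) (j | j)
      · exact hscaled 0 i j
      · exact he i
      · exact ((hcE j).const_mul (C j)).neg
      · exact tendsto_const_nhds
    have h := hg.div (hlim 0) hL0
    rw [zero_div] at h
    refine h.congr fun x => ?_
    rw [Pi.div_apply, hscaled_det, mul_div_mul_left _ _ (hD x), f]
  · have h := ((hlim 1).div (hlim 0) hL0).norm
    have h1 : ‖(L 1).det / (L 0).det‖ = 1 := by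
      rw [hLdet 1, hLdet 0, hL1, mul_div_mul_right _ _ hLc, mul_div_cancel_right₀ _ hcauchy,
        norm_prod]
      exact Finset.prod_eq_one fun i _ => by
        rw [norm_neg, norm_div, RCLike.norm_conj, div_self (norm_ne_zero_iff.2 (hp0 i))]
    rw [h1] at h
    refine h.congr fun x => ?_
    rw [Pi.div_apply, hscaled_det, hscaled_det, mul_div_mul_left _ _ (hD x), f, h₂]

lemma asymptotics (hpp : ∀ i j, p i + conj (p j) ≠ 0) (hnd : Nondegenerate c₁ c₂ ρ₂ p C) (t : ℝ) :
    (∀ᶠ x in atBot ⊔ atTop, f c₁ c₂ ρ₂ p ξ₀ C x t ≠ 0) ∧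
      Tendsto (fun x => g₁ c₁ c₂ ρ₂ p ξ₀ C x t / f c₁ c₂ ρ₂ p ξ₀ C x t) (atBot ⊔ atTop) (𝓝 0) ∧
      Tendsto (fun x => ‖h₂ c₁ c₂ ρ₂ p ξ₀ C x t / f c₁ c₂ ρ₂ p ξ₀ C x t‖) (atBot ⊔ atTop)
        (𝓝 1) := by
  classical
  have hre : ∀ i, (p i).re ≠ 0 := by
    intro i h
    apply hpp i i
    rw [Complex.add_conj, h]
    simp
  have hpos : ∀ i, ¬0 < (p i).re ↔ (p i).re < 0 := fun i =>
    ⟨fun h => lt_of_le_of_ne (not_lt.1 h) (hre i), fun h => h.le.not_gt⟩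
  have hneg : ∀ i, ¬(p i).re < 0 ↔ 0 < (p i).re := fun i =>
    ⟨fun h => lt_of_le_of_ne (not_lt.1 h) (hre i).symm, fun h => h.le.not_gt⟩
  -- At +∞ the exponentials with Re p_i > 0 blow up, so the minor needed is the one on Re p_i < 0;
  -- at −∞ the roles are exchanged. No index has Re p_i = 0, because p_i + p_i^* ≠ 0.
  obtain ⟨a1, a2, a3⟩ := asymptotics_of_dichotomy (ξ₀ := ξ₀) hpp hnd.injective
    (fun i => 0 < (p i).re) (by
      rw [Matrix.equiv_block_det _ fun i => (hpos i).symm]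
      convert! hnd.det_neg) atTop t
    (fun i hi => tendsto_exp_zero (by
      obtain ⟨c, hc⟩ := exists_re_phase_eq c₂ ρ₂ p ξ₀ t i
      simp only [Complex.neg_re, hc]
      exact tendsto_neg_atTop_atBot.comp
        (tendsto_atTop_add_const_right _ _ (tendsto_id.const_mul_atTop hi))))
    (fun i hi => tendsto_exp_zero (by
      obtain ⟨c, hc⟩ := exists_re_phase_eq c₂ ρ₂ p ξ₀ t i
      simp only [hc]
      exact tendsto_atBot_add_const_right _ _
        (tendsto_id.const_mul_atTop_of_neg ((hpos i).1 hi))))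
  obtain ⟨b1, b2, b3⟩ := asymptotics_of_dichotomy (ξ₀ := ξ₀) hpp hnd.injective
    (fun i => (p i).re < 0) (by
      rw [Matrix.equiv_block_det _ fun i => (hneg i).symm]
      convert! hnd.det_pos) atBot t
    (fun i hi => tendsto_exp_zero (by
      obtain ⟨c, hc⟩ := exists_re_phase_eq c₂ ρ₂ p ξ₀ t i
      simp only [Complex.neg_re, hc]
      exact tendsto_neg_atTop_atBot.comp
        (tendsto_atTop_add_const_right _ _ (tendsto_id.const_mul_atBot_of_neg hi))))
    (fun i hi => tendsto_exp_zero (by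
      obtain ⟨c, hc⟩ := exists_re_phase_eq c₂ ρ₂ p ξ₀ t i
      simp only [hc]
      exact tendsto_atBot_add_const_right _ _
        (tendsto_id.const_mul_atBot ((hneg i).1 hi))))
  exact ⟨eventually_sup.2 ⟨b1, a1⟩, b2.sup a2, b3.sup a3⟩

end Asymptotics

end SSmKdV

theorem theorem3p3 (N : ℕ) (c₁ c₂ ρ₂ : ℝ) (hρ₂ : 0 < ρ₂) (p ξ₀ C : Fin N → ℂ)
    (hp : ∀ i, conj (p i.rev) = p i) (hξ₀ : ∀ i, conj (ξ₀ i.rev) = ξ₀ i)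
    (hpp : ∀ i j, p i + conj (p j) ≠ 0)
    (hcoeff : ∀ i j, (c₂ * ρ₂ ^ 2 / (p i * conj (p j)) - 1 : ℂ) ≠ 0) :
    ∃ (u : ℝ → ℝ → ℂ) (v : ℝ → ℝ → ℝ),
      (∀ x t, u x t = SSmKdV.g₁ c₁ c₂ ρ₂ p ξ₀ C x t / SSmKdV.f c₁ c₂ ρ₂ p ξ₀ C x t) ∧
      (∀ x t, (v x t : ℂ) =
        ρ₂ * (SSmKdV.h₂ c₁ c₂ ρ₂ p ξ₀ C x t / SSmKdV.f c₁ c₂ ρ₂ p ξ₀ C x t)) ∧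
      SSmKdV.IsSolutionOn c₁ c₂ u v {z | SSmKdV.f c₁ c₂ ρ₂ p ξ₀ C z.1 z.2 ≠ 0} ∧
      (SSmKdV.Nondegenerate c₁ c₂ ρ₂ p C →
        (∀ t, ∀ᶠ x in atBot ⊔ atTop, SSmKdV.f c₁ c₂ ρ₂ p ξ₀ C x t ≠ 0) ∧
        SSmKdV.BrightDarkBoundary ρ₂ u v) := by
  have hv : ∀ x t, (((ρ₂ * (SSmKdV.h₂ c₁ c₂ ρ₂ p ξ₀ C x t
      / SSmKdV.f c₁ c₂ ρ₂ p ξ₀ C x t) : ℂ).re : ℝ) : ℂ)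
      = ρ₂ * (SSmKdV.h₂ c₁ c₂ ρ₂ p ξ₀ C x t / SSmKdV.f c₁ c₂ ρ₂ p ξ₀ C x t) := by
    intro x t
    -- Conjugating M₀ or M₁ only permutes rows and columns simultaneously, so both determinants are
    -- real; the equality also holds where f = 0, with quotient 0 by convention.
    rw [← Complex.conj_eq_iff_re, map_mul, map_div₀, Complex.conj_ofReal, SSmKdV.h₂, SSmKdV.f,
      SSmKdV.conj_det_mat hp hξ₀, SSmKdV.conj_det_mat hp hξ₀]
  refine ⟨fun x t => SSmKdV.g₁ c₁ c₂ ρ₂ p ξ₀ C x t / SSmKdV.f c₁ c₂ ρ₂ p ξ₀ C x t,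
    fun x t => (ρ₂ * (SSmKdV.h₂ c₁ c₂ ρ₂ p ξ₀ C x t / SSmKdV.f c₁ c₂ ρ₂ p ξ₀ C x t) : ℂ).re,
    fun x t => rfl, hv, SSmKdV.isSolutionOn hp hξ₀ hpp hcoeff (fun x t => rfl) hv, fun hnd =>
    ⟨fun t => (SSmKdV.asymptotics hpp hnd t).1, fun t =>
      ⟨(SSmKdV.asymptotics hpp hnd t).2.1, ?_⟩⟩⟩
  have h := (SSmKdV.asymptotics (ξ₀ := ξ₀) hpp hnd t).2.2.const_mul ρ₂
  rw [mul_one] at h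
  refine h.congr fun x => ?_
  rw [← Real.norm_eq_abs, ← Complex.norm_real, hv, norm_mul, Complex.norm_real,
    Real.norm_of_nonneg hρ₂.le]
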